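/- Let $\mathcal A$ be the mod 2 Steenrod algebra, i.e. the $\mathbb F_2$-algebra generated by the Steenrod squares $Sq^i$ ($i\geqslant 0$) subject to $Sq^0=1$ and the Adem relations, and let $P_5=\mathbb F_2[x_1,x_2,x_3,x_4,x_5]$ be the polynomial algebra with each $x_j$ of degree $1$. It is an $\mathcal A$-module by $Sq^0(x_j)=x_j$, $Sq^1(x_j)=x_j^2$, $Sq^i(x_j)=0$ for $i>1$, $Sq^i(1)=0$ for $i>0$, and the Cartan formula $Sq^d(gh)=\sum_{j=0}^{d}Sq^j(g)Sq^{d-j}(h)$. Let $QP_5=\mathbb F_2\otimes_{\mathcal A}P_5=P_5/\mathcal A^+P_5$, where $\mathcal A^+$ is the augmentation ideal of $\mathcal A$ (the elements of positive degree), and write $[f]\in QP_5$ for the class of $f\in P_5$. Let $(QP_5)_{20}$ be the subspace of classes of homogeneous polynomials of degree $20$. The group $GL_5=GL_5(\mathbb F_2)$ acts on $P_5$ by linear substitution of the variables; this action commutes with that of $\mathcal A$ and so induces an action on $QP_5$. Let $(QP_5)_{20}^{GL_5}$ be the subspace of $GL_5$-invariant classes of degree $20$. Theorem. The $\mathbb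 F_2$-vector space $(QP_5)_{20}^{GL_5}$ has dimension one, and it is spanned by the class $[p]$ of the polynomial $$\begin{aligned} p &= x_1x_2x_3^{3}x_4^{3}x_5^{12} + x_1x_2x_3^{3}x_4^{5}x_5^{10} + x_1x_2x_3^{3}x_4^{6}x_5^{9} + x_1x_2x_3^{3}x_4^{12}x_5^{3} \\ &\quad + x_1x_2x_3^{6}x_4^{3}x_5^{9} + x_1x_2x_3^{6}x_4^{9}x_5^{3} + x_1x_2^{3}x_3x_4^{3}x_5^{12} + x_1x_2^{3}x_3x_4^{5}x_5^{10} \\ &\quad + x_1x_2^{3}x_3x_4^{6}x_5^{9} + x_1x_2^{3}x_3x_4^{12}x_5^{3} + x_1x_2^{3}x_3^{3}x_4^{4}x_5^{9} + x_1x_2^{3}x_3^{3}x_4^{5}x_5^{8} \\ &\quad + x_1x_2^{3}x_3^{5}x_4^{3}x_5^{8} + x_1x_2^{3}x_3^{5}x_4^{8}x_5^{3} + x_1x_2^{6}x_3x_4^{3}x_5^{9} + x_1x_2^{6}x_3x_4^{9}x_5^{3} \\ &\quad + x_1^{3}x_2x_3^{4}x_4^{3}x_5^{9} + x_1^{3}x_2x_3^{4}x_4^{9}x_5^{3}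 + x_1^{3}x_2x_3^{5}x_4^{3}x_5^{8} + x_1^{3}x_2x_3^{5}x_4^{8}x_5^{3} \\ &\quad + x_1^{3}x_2^{4}x_3x_4^{3}x_5^{9} + x_1^{3}x_2^{4}x_3x_4^{9}x_5^{3} + x_1^{3}x_2^{5}x_3x_4^{3}x_5^{8} + x_1^{3}x_2^{5}x_3x_4^{8}x_5^{3} \\ &\quad + x_1x_2^{3}x_3^{5}x_4^{5}x_5^{6} + x_1x_2^{3}x_3^{5}x_4^{6}x_5^{5} + x_1x_2^{3}x_3^{6}x_4^{5}x_5^{5} + x_1x_2^{6}x_3^{3}x_4^{5}x_5^{5} \\ &\quad + x_1^{3}x_2x_3^{5}x_4^{5}x_5^{6} + x_1^{3}x_2x_3^{5}x_4^{6}x_5^{5} + x_1^{3}x_2^{5}x_3x_4^{5}x_5^{6} + x_1^{3}x_2^{5}x_3x_4^{6}x_5^{5} \\ &\quad + x_1^{3}x_2^{3}x_3^{4}x_4^{5}x_5^{5} + x_1^{3}x_2^{3}x_3^{5}x_4^{4}x_5^{5} + x_1^{3}x_2^{3}x_3^{5}x_4^{5}x_5^{4} + x_1^{3}x_2^{4}x_3^{3}x_4^{5}x_5^{5}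 \\ &\quad + x_1^{3}x_2^{5}x_3^{3}x_4^{4}x_5^{5} + x_1^{3}x_2^{5}x_3^{3}x_4^{5}x_5^{4} + x_1^{3}x_2^{5}x_3^{5}x_4^{3}x_5^{4} + x_1^{3}x_2^{5}x_3^{5}x_4^{4}x_5^{3}. \end{aligned}$$ -/

import Mathlib

noncomputable section

namespace SteenrodHit

open MvPolynomial Finset

/-- The polynomial algebra `P_k = 𝔽₂[x_1, …, x_k]`; the variable `x_j` is `X (j - 1)`. -/
abbrev Poly (k : ℕ) : Type := MvPolynomial (Fin k) (ZMod 2)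

/-- The total Steenrod square `f ↦ ∑ i, Sq^i(f) t^i`: the homomorphism of algebras
`P_k → P_k[t]` with `x_j ↦ x_j + x_j² t`. That it is multiplicative is the Cartan formula. -/
def totalSq (k : ℕ) : Poly k →ₐ[ZMod 2] Polynomial (Poly k) :=
  aeval fun j => Polynomial.C (X j) + Polynomial.C (X j ^ 2) * Polynomial.X

/-- The Steenrod square `Sq^i : P_k → P_k`. -/
def Sq (k i : ℕ) : Module.End (ZMod 2) (Poly k) where
  toFun f := (totalSq k f).coeff i
  map_add' f g := by simp
  map_smul' c f := by simp

theorem sq_apply (k i : ℕ) (f : Poly k) : Sq k i f = (totalSq k f).coeff i := rfl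

/-! ### The Adem relations hold for the Steenrod squares on polynomials -/

/-- `Sq^n` for an integer `n`, zero for negative `n`. -/
def sqInt (k : ℕ) (n : ℤ) : Module.End (ZMod 2) (Poly k) :=
  if n < 0 then 0 else Sq k n.toNat

/-- Binomial coefficients modulo 2 for integers, zero for a negative lower entry. -/
def binomInt (n m : ℤ) : ZMod 2 :=
  if m < 0 then 0 else ((Ring.choose n m.toNat : ℤ) : ZMod 2)

theorem sqInt_neg (k : ℕ) {n : ℤ} (h : n < 0) : sqInt k n = 0 := by simp [sqInt, h]

theorem sqInt_natCast (k n : ℕ) : sqInt k (n : ℤ) = Sq k n := by simp [sqInt]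

theorem binomInt_neg (n : ℤ) {m : ℤ} (h : m < 0) : binomInt n m = 0 := by simp [binomInt, h]

theorem binomInt_natCast (n m : ℕ) : binomInt (n : ℤ) (m : ℤ) = (n.choose m : ZMod 2) := by
  simp only [binomInt, Int.toNat_natCast]
  rw [if_neg (by omega), Ring.choose_natCast]
  simp

theorem binomInt_pascal (n m : ℤ) :
    binomInt (n + 1) m = binomInt n m + binomInt n (m - 1) := by
  rcases lt_trichotomy m 0 with h | rfl | h
  · simp [binomInt_neg _ h, binomInt_neg _ (show m - 1 < 0 by omega)]
  · simp [binomInt]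
  · obtain ⟨j, rfl⟩ : ∃ j : ℕ, m = (j : ℤ) + 1 := ⟨(m - 1).toNat, by omega⟩
    have e : ((j : ℤ) + 1).toNat = j + 1 := by omega
    simp only [binomInt, add_sub_cancel_right, e, Int.toNat_natCast]
    rw [if_neg (by omega), if_neg (by omega), if_neg (by omega), Ring.choose_succ_succ]
    push_cast
    ring

theorem binomInt_central (n : ℕ) (h : 0 < n) : binomInt (-(n : ℤ) - 1) n = 0 := by
  simp only [binomInt, Int.toNat_natCast]
  rw [if_neg (by omega), show (-(n : ℤ) - 1) = -((n : ℤ) + 1) by ring, Ring.choose_neg]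
  have e : ((n : ℤ) + 1 + n - 1) = ((2 * n : ℕ) : ℤ) := by push_cast; ring
  rw [e, Ring.choose_natCast]
  have h2 : ((Nat.centralBinom n : ℕ) : ZMod 2) = 0 :=
    (ZMod.natCast_eq_zero_iff _ _).2 (Nat.two_dvd_centralBinom_of_one_le h)
  rw [Nat.centralBinom] at h2
  rw [Units.smul_def, zsmul_eq_mul]
  push_cast
  rw [h2, mul_zero]

theorem sqInt_X_mul (k : ℕ) (n : ℤ) (j : Fin k) (f : Poly k) :
    sqInt k n (X j * f) = X j * sqInt k n f + X j ^ 2 * sqInt k (n - 1) f := by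
  rcases lt_trichotomy n 0 with h | rfl | h
  · simp [sqInt_neg k h, sqInt_neg k (show n - 1 < 0 by omega)]
  · rw [sqInt_neg k (show (0 : ℤ) - 1 < 0 by omega)]
    simp [sqInt, sq_apply, totalSq, add_mul, mul_assoc]
  · obtain ⟨i, rfl⟩ : ∃ i : ℕ, n = (i : ℤ) + 1 := ⟨(n - 1).toNat, by omega⟩
    rw [add_sub_cancel_right, sqInt_natCast, show (i : ℤ) + 1 = ((i + 1 : ℕ) : ℤ) by simp,
      sqInt_natCast]
    simp only [sq_apply, map_mul, totalSq, aeval_X]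
    rw [add_mul, Polynomial.coeff_add, mul_assoc, Polynomial.coeff_C_mul, Polynomial.coeff_C_mul,
      Polynomial.coeff_X_mul]

theorem sqInt_X_sq_mul (k : ℕ) (n : ℤ) (j : Fin k) (f : Poly k) :
    sqInt k n (X j ^ 2 * f) = X j ^ 2 * sqInt k n f + X j ^ 4 * sqInt k (n - 2) f := by
  rw [pow_two, mul_assoc, sqInt_X_mul, sqInt_X_mul, sqInt_X_mul, show n - 1 - 1 = n - 2 by ring]
  have h2 : (2 : Poly k) = 0 := CharTwo.two_eq_zero
  linear_combination (X j ^ 3 * sqInt k (n - 1) f) * h2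

theorem sqInt_one (k : ℕ) (n : ℤ) : sqInt k n 1 = if n = 0 then 1 else 0 := by
  by_cases h : n < 0
  · simp [sqInt_neg k h, h.ne]
  · obtain ⟨i, rfl⟩ : ∃ i : ℕ, n = (i : ℤ) := ⟨n.toNat, by omega⟩
    simp [sqInt_natCast, sq_apply, Polynomial.coeff_one]

theorem adem_sqInt (k : ℕ) (f : Poly k) : ∀ (N : ℕ) (a b : ℤ), a < 2 * N →
    sqInt k a (sqInt k b f) =
      ∑ j ∈ range N, binomInt (b - 1 - j) (a - 2 * j) • sqInt k (a + b - j) (sqInt k j f) := by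
  induction f using MvPolynomial.induction_on with
  | C c =>
    intro N a b hN
    have hc : (C c : Poly k) = c • 1 := by rw [smul_eq_C_mul, mul_one]
    rw [hc]
    simp only [map_smul]
    simp_rw [smul_comm _ c]
    rw [← Finset.smul_sum]
    congr 1
    simp only [sqInt_one]
    rcases N with _ | N
    · have : a < 0 := by simpa using hN
      simp [sqInt_neg k this]
    · rw [Finset.sum_range_succ', Finset.sum_eq_zero]
      · by_cases hb : b = 0
        · subst hb
          by_cases ha : a = 0
          · subst ha
            simp [sqInt_one, binomInt]
          · simp [sqInt_one, ha]
        · by_cases hab : a + b = 0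
          · have ha : a = -b := by omega
            subst ha
            by_cases hb' : b < 0
            · have := binomInt_central (-b).toNat (by omega)
              have e : ((-b).toNat : ℤ) = -b := by omega
              rw [e] at this
              simp only [neg_neg] at this
              simp [hb, this]
            · simp [hb, binomInt_neg _ (show -b < 0 by omega)]
          · simp [hb, sqInt_one, hab]
      · intro j _
        rw [if_neg (by omega)]
        simp
  | add f g hf hg =>
    intro N a b hN
    simp only [map_add, smul_add, Finset.sum_add_distrib, hf N a b hN, hg N a b hN]
  | mul_X f i hf =>
    intro N a b hN
    rcases N with _ | N
    · have : a < 0 := by simpa using hN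
      simp [sqInt_neg k this]
    set x : Poly k := X i with hx
    rw [mul_comm f x]
    have key : ∀ c d : ℤ, sqInt k c (sqInt k d (x * f)) =
        x * sqInt k c (sqInt k d f)
          + x ^ 2 * (sqInt k (c - 1) (sqInt k d f) + sqInt k c (sqInt k (d - 1) f))
          + x ^ 4 * sqInt k (c - 2) (sqInt k (d - 1) f) := by
      intro c d
      rw [hx, sqInt_X_mul, map_add, sqInt_X_mul, sqInt_X_sq_mul]
      ring
    rw [key, hf (N + 1) a b hN, hf (N + 1) (a - 1) b (by push_cast at hN ⊢; omega),
      hf (N + 1) a (b - 1) hN, hf N (a - 2) (b - 1) (by push_cast at hN ⊢; omega)]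
    simp only [key, smul_add, Finset.sum_add_distrib, mul_smul_comm, Finset.mul_sum, mul_add]
    have h4 : ∑ j ∈ range (N + 1), binomInt (b - 1 - j) (a - 2 * j) •
          (x ^ 4 * sqInt k (a + b - j - 2) (sqInt k (j - 1) f)) =
        ∑ j ∈ range N, binomInt (b - 1 - 1 - j) (a - 2 - 2 * j) •
          (x ^ 4 * sqInt k (a - 2 + (b - 1) - j) (sqInt k j f)) := by
      rw [Finset.sum_range_succ']
      simp only [Nat.cast_zero, zero_sub, sqInt_neg k (show (-1 : ℤ) < 0 by omega),
        LinearMap.zero_apply, map_zero, mul_zero, smul_zero, add_zero]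
      refine Finset.sum_congr rfl fun j _ => ?_
      push_cast
      rw [show b - 1 - ((j : ℤ) + 1) = b - 1 - 1 - j by ring,
        show a - 2 * ((j : ℤ) + 1) = a - 2 - 2 * j by ring,
        show a + b - ((j : ℤ) + 1) - 2 = a - 2 + (b - 1) - j by ring,
        show (j : ℤ) + 1 - 1 = j by ring]
    have h2 : ∑ j ∈ range (N + 1), binomInt (b - 1 - j) (a - 2 * j) •
          (x ^ 2 * sqInt k (a + b - j) (sqInt k (j - 1) f)) =
        ∑ j ∈ range (N + 1), binomInt (b - 2 - j) (a - 2 - 2 * j) •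
          (x ^ 2 * sqInt k (a + b - 1 - j) (sqInt k j f)) := by
      rw [Finset.sum_range_succ', Finset.sum_range_succ]
      simp only [Nat.cast_zero, zero_sub, sqInt_neg k (show (-1 : ℤ) < 0 by omega),
        LinearMap.zero_apply, map_zero, mul_zero, smul_zero, add_zero]
      rw [binomInt_neg _ (show a - 2 - 2 * (N : ℤ) < 0 by push_cast at hN; omega), zero_smul,
        add_zero]
      refine Finset.sum_congr rfl fun j _ => ?_
      push_cast
      rw [show b - 1 - ((j : ℤ) + 1) = b - 2 - j by ring,
        show a - 2 * ((j : ℤ) + 1) = a - 2 - 2 * j by ring,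
        show a + b - ((j : ℤ) + 1) = a + b - 1 - j by ring,
        show (j : ℤ) + 1 - 1 = j by ring]
    rw [h4, h2]
    refine congrArg₂ (· + ·) (congrArg₂ (· + ·) rfl ?_) rfl
    rw [← Finset.sum_add_distrib, ← Finset.sum_add_distrib]
    refine Finset.sum_congr rfl fun j _ => ?_
    rw [show a - 1 + b - (j : ℤ) = a + b - 1 - j by ring,
      show a + (b - 1) - (j : ℤ) = a + b - 1 - j by ring,
      show a + b - (j : ℤ) - 1 = a + b - 1 - j by ring, ← add_smul, ← add_smul]
    congr 1
    have p1 := binomInt_pascal (b - 2 - j) (a - 2 * j)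
    have p2 := binomInt_pascal (b - 2 - j) (a - 1 - 2 * j)
    rw [show b - 2 - (j : ℤ) + 1 = b - 1 - j by ring] at p1 p2
    rw [show b - 1 - 1 - (j : ℤ) = b - 2 - j by ring, p1, p2,
      show a - 1 - 2 * (j : ℤ) - 1 = a - 2 - 2 * j by ring,
      show a - 2 * (j : ℤ) - 1 = a - 1 - 2 * j by ring]
    ring

theorem sq_zero (k : ℕ) : Sq k 0 = 1 := by
  refine LinearMap.ext fun f => ?_
  change Sq k 0 f = f
  induction f using MvPolynomial.induction_on with
  | C c => simp [sq_apply, totalSq, Polynomial.algebraMap_apply, MvPolynomial.algebraMap_eq]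
  | add f g hf hg => rw [map_add, hf, hg]
  | mul_X f i hf =>
    have h := sqInt_X_mul k 0 i f
    rw [sqInt_neg k (show (0 : ℤ) - 1 < 0 by omega), ← Nat.cast_zero, sqInt_natCast, hf] at h
    rw [mul_comm, h]
    simp

theorem adem_sq (k a b : ℕ) (hab : a < 2 * b) :
    Sq k a * Sq k b = ∑ j ∈ range (a / 2 + 1),
      ((b - 1 - j).choose (a - 2 * j) : ZMod 2) • (Sq k (a + b - j) * Sq k j) := by
  refine LinearMap.ext fun f => ?_
  have h := adem_sqInt k f (a / 2 + 1) a b (by push_cast; omega)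
  simp only [sqInt_natCast] at h
  rw [Module.End.mul_apply, h, LinearMap.sum_apply]
  refine Finset.sum_congr rfl fun j hj => ?_
  have hj' : j ≤ a / 2 := by simpa [Nat.lt_succ_iff] using hj
  have e1 : (b : ℤ) - 1 - j = ((b - 1 - j : ℕ) : ℤ) := by omega
  have e2 : (a : ℤ) - 2 * j = ((a - 2 * j : ℕ) : ℤ) := by omega
  have e3 : (a : ℤ) + b - j = ((a + b - j : ℕ) : ℤ) := by omega
  rw [e1, e2, e3, binomInt_natCast, sqInt_natCast]
  rfl

/-! ### The Steenrod algebra and its module `P_k` -/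

/-- The relations between the generators `Sq^i`, `i ≥ 0`, of the mod 2 Steenrod algebra:
`Sq^0 = 1` and the Adem relations. -/
inductive AdemRel : FreeAlgebra (ZMod 2) ℕ → FreeAlgebra (ZMod 2) ℕ → Prop
  | one : AdemRel (FreeAlgebra.ι (ZMod 2) 0) 1
  | adem (a b : ℕ) (ha : 0 < a) (hab : a < 2 * b) :
      AdemRel (FreeAlgebra.ι (ZMod 2) a * FreeAlgebra.ι (ZMod 2) b)
        (∑ j ∈ range (a / 2 + 1), ((b - 1 - j).choose (a - 2 * j) : ZMod 2) •
          (FreeAlgebra.ι (ZMod 2) (a + b - j) * FreeAlgebra.ι (ZMod 2) j))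

/-- The mod 2 Steenrod algebra `𝒜`. -/
abbrev SteenrodAlgebra : Type := RingQuot AdemRel

/-- The action of the Steenrod algebra on `P_k`, the generator `Sq^i` acting as `Sq k i`. -/
def action (k : ℕ) : SteenrodAlgebra →ₐ[ZMod 2] Module.End (ZMod 2) (Poly k) :=
  RingQuot.liftAlgHom (ZMod 2) ⟨FreeAlgebra.lift (ZMod 2) (Sq k), by
    intro x y h
    induction h with
    | one => simp [sq_zero]
    | adem a b ha hab => simp [adem_sq k a b hab]⟩

/-- The augmentation `𝒜 → 𝔽₂`, which is zero in positive degrees. -/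
def augmentation : SteenrodAlgebra →ₐ[ZMod 2] ZMod 2 :=
  RingQuot.liftAlgHom (ZMod 2) ⟨FreeAlgebra.lift (ZMod 2) fun i => if i = 0 then 1 else 0, by
    intro x y h
    induction h with
    | one => simp
    | adem a b ha hab =>
      simp only [map_mul, FreeAlgebra.lift_ι_apply, map_sum, map_smul]
      rw [if_neg ha.ne', zero_mul, Finset.sum_eq_zero]
      intro j hj
      have hj' : j ≤ a / 2 := by simpa [Nat.lt_succ_iff] using hj
      rw [if_neg (by omega), zero_mul, smul_zero]⟩

/-- The subspace `𝒜⁺ P_k` of hit polynomials, `𝒜⁺` being the augmentation ideal of `𝒜`. -/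
def hit (k : ℕ) : Submodule (ZMod 2) (Poly k) :=
  Submodule.span (ZMod 2) {h | ∃ θ f, augmentation θ = 0 ∧ action k θ f = h}

/-- `QP_k = 𝔽₂ ⊗_𝒜 P_k = P_k / 𝒜⁺ P_k`. -/
abbrev QP (k : ℕ) : Type := Poly k ⧸ hit k

/-- The class `[f]` in `QP_k` of a polynomial `f`. -/
def cls (k : ℕ) : Poly k →ₗ[ZMod 2] QP k := (hit k).mkQ

/-- `(QP_k)_d`, the subspace of the classes of homogeneous polynomials of degree `d`. -/
def QPdeg (k d : ℕ) : Submodule (ZMod 2) (QP k) :=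
  (homogeneousSubmodule (Fin k) (ZMod 2) d).map (cls k)

/-! ### The action of the general linear group -/

/-- Substitution of a matrix in the variables: `x_j ↦ ∑ i, g_{ij} x_i`. -/
def subst (k : ℕ) (g : Matrix (Fin k) (Fin k) (ZMod 2)) : Poly k →ₐ[ZMod 2] Poly k :=
  aeval fun j => ∑ i, g i j • X i

theorem subst_one (k : ℕ) : subst k 1 = AlgHom.id (ZMod 2) (Poly k) := by
  refine MvPolynomial.algHom_ext fun j => ?_
  simp [subst, Matrix.one_apply]

theorem subst_mul (k : ℕ) (g h : Matrix (Fin k) (Fin k) (ZMod 2)) :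
    subst k (g * h) = (subst k g).comp (subst k h) := by
  refine MvPolynomial.algHom_ext fun j => ?_
  simp only [subst, aeval_X, AlgHom.comp_apply, map_sum, map_smul, Matrix.mul_apply,
    Finset.smul_sum, Finset.sum_smul, smul_smul]
  rw [Finset.sum_comm]
  simp_rw [mul_comm]

theorem totalSq_subst (k : ℕ) (g : Matrix (Fin k) (Fin k) (ZMod 2)) :
    (totalSq k).comp (subst k g) = (Polynomial.mapAlgHom (subst k g)).comp (totalSq k) := by
  refine MvPolynomial.algHom_ext fun j => ?_
  have hz : ∀ c : ZMod 2, c ^ 2 = c := by decide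
  have hs : (∑ i, g i j • (X i : Poly k)) ^ 2 = ∑ i, g i j • (X i : Poly k) ^ 2 := by
    rw [CharTwo.sum_sq]
    refine Finset.sum_congr rfl fun i _ => ?_
    rw [smul_pow, hz]
  have hl : totalSq k (subst k g (X j)) =
      ∑ i, g i j • (Polynomial.C (X i : Poly k) + Polynomial.C (X i ^ 2) * Polynomial.X) := by
    simp only [subst, totalSq, aeval_X, map_sum, map_smul]
  have hr : Polynomial.mapAlgHom (subst k g) (totalSq k (X j)) =
      Polynomial.C (∑ i, g i j • (X i : Poly k)) +
        Polynomial.C ((∑ i, g i j • (X i : Poly k)) ^ 2) * Polynomial.X := by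
    simp [subst, totalSq]
  rw [AlgHom.comp_apply, AlgHom.comp_apply, hl, hr, hs, map_sum, map_sum, Finset.sum_mul,
    ← Finset.sum_add_distrib]
  refine Finset.sum_congr rfl fun i _ => ?_
  rw [smul_add, Polynomial.smul_C, ← smul_mul_assoc, Polynomial.smul_C]

theorem sq_subst (k i : ℕ) (g : Matrix (Fin k) (Fin k) (ZMod 2)) (f : Poly k) :
    Sq k i (subst k g f) = subst k g (Sq k i f) := by
  have h := congrArg (fun p => Polynomial.coeff p i) (DFunLike.congr_fun (totalSq_subst k g) f)
  simpa [sq_apply] using h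

theorem action_subst (k : ℕ) (g : Matrix (Fin k) (Fin k) (ZMod 2)) (θ : SteenrodAlgebra)
    (f : Poly k) : action k θ (subst k g f) = subst k g (action k θ f) := by
  obtain ⟨u, rfl⟩ := RingQuot.mkAlgHom_surjective (ZMod 2) AdemRel θ
  rw [action, RingQuot.liftAlgHom_mkAlgHom_apply]
  induction u using FreeAlgebra.induction generalizing f with
  | grade0 c => simp [Module.algebraMap_end_apply]
  | grade1 i => simp [sq_subst]
  | mul a b ha hb => simp [ha, hb]
  | add a b ha hb => simp [ha, hb]

theorem hit_le_comap (k : ℕ) (g : Matrix (Fin k) (Fin k) (ZMod 2)) :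
    hit k ≤ (hit k).comap (subst k g).toLinearMap := by
  rw [hit, Submodule.span_le]
  rintro _ ⟨θ, f, hθ, rfl⟩
  exact Submodule.subset_span ⟨θ, subst k g f, hθ, action_subst k g θ f⟩

/-- The action of `GL_k = GL_k(𝔽₂)` on `QP_k` induced by matrix substitution, `g [f] = [g f]`. -/
def glAction (k : ℕ) : Representation (ZMod 2) (GL (Fin k) (ZMod 2)) (QP k) where
  toFun g := (hit k).mapQ (hit k) (subst k g.val).toLinearMap (hit_le_comap k g.val)
  map_one' := by
    refine LinearMap.ext fun q => ?_
    obtain ⟨f, rfl⟩ := (hit k).mkQ_surjective q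
    simp [subst_one]
  map_mul' g h := by
    refine LinearMap.ext fun q => ?_
    obtain ⟨f, rfl⟩ := (hit k).mkQ_surjective q
    simp [subst_mul]

/-- `(QP_k)_d^{GL_k}`, the subspace of the `GL_k`-invariant classes of degree `d`. -/
def QPinv (k d : ℕ) : Submodule (ZMod 2) (QP k) := QPdeg k d ⊓ (glAction k).invariants

/-- The monomial `x_1^a x_2^b x_3^c x_4^d x_5^e`. -/
def mon (a b c d e : ℕ) : Poly 5 := X 0 ^ a * X 1 ^ b * X 2 ^ c * X 3 ^ d * X 4 ^ e

/-- The polynomial `p` of degree 20, a sum of 40 monomials. -/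
def p : Poly 5 :=
    mon 1 1 3 3 12 + mon 1 1 3 5 10 + mon 1 1 3 6 9 + mon 1 1 3 12 3 +
    mon 1 1 6 3 9 + mon 1 1 6 9 3 + mon 1 3 1 3 12 + mon 1 3 1 5 10 +
    mon 1 3 1 6 9 + mon 1 3 1 12 3 + mon 1 3 3 4 9 + mon 1 3 3 5 8 +
    mon 1 3 5 3 8 + mon 1 3 5 8 3 + mon 1 6 1 3 9 + mon 1 6 1 9 3 +
    mon 3 1 4 3 9 + mon 3 1 4 9 3 + mon 3 1 5 3 8 + mon 3 1 5 8 3 +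
    mon 3 4 1 3 9 + mon 3 4 1 9 3 + mon 3 5 1 3 8 + mon 3 5 1 8 3 +
    mon 1 3 5 5 6 + mon 1 3 5 6 5 + mon 1 3 6 5 5 + mon 1 6 3 5 5 +
    mon 3 1 5 5 6 + mon 3 1 5 6 5 + mon 3 5 1 5 6 + mon 3 5 1 6 5 +
    mon 3 3 4 5 5 + mon 3 3 5 4 5 + mon 3 3 5 5 4 + mon 3 4 3 5 5 +
    mon 3 5 3 4 5 + mon 3 5 3 5 4 + mon 3 5 5 3 4 + mon 3 5 5 4 3

end SteenrodHit

end

noncomputable section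

namespace SteenrodHit

open MvPolynomial

/-! The proof bounds the invariants from above over an extension of 𝔽₂ and exhibits one nonzero
invariant class over 𝔽₂.

Upper bound. Identify 𝔽₂⁵ with 𝔽₃₂ = 𝔽₂(α), where α⁵ = α² + 1. Multiplication by α (order 31), the
Frobenius map (order 5) and δ ↦ δ + δ⁴ + δ⁸ then become elements of GL₅. Over a field containing α
there are coordinates `y_i` in which x_j = ∑ (α^j)^(2^i) y_i. In these coordinates multiplication by
α is diagonal, y_i ↦ α^(2^i) y_i, and Frobenius is the rotation y_i ↦ y_{i-1}. The price is that the
total square is twisted to y_j ↦ y_j + y_{j-1}² t. Since 31 and 5 are odd, summing an invariant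
class over the powers of these two maps does not change it. An invariant class is therefore a
combination of rotation orbit sums of monomials whose weight is divisible by 31
(`rotSum_powSum_diagMap_mem`). Explicit twisted squares reduce all such orbit sums in degree 20 to
five (`rotSum_mono_mem`). Invariance under the third map, tested by four functionals that vanish on
hit polynomials, leaves only one of the five (`exists_sub_smul_mem_hits`). The three elements enter
only through necessary conditions, so nothing about the group they generate is needed.

Lower bound. For the adjacent transpositions and one transvection g, the polynomial g p - p is
written as an explicit sum of Steenrod squares. Elimination extends this to all of GL₅
(`subst_p_sub_mem`). A sum of forty coefficients vanishes on hit polynomials and takes the value 1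
on p (`exists_functional`), so p is not hit.

Descent. Over the extension both f and p are multiples of the same orbit sum modulo hit polynomials.
Functionals defined over 𝔽₂ turn this into f ≡ φ(f) p over 𝔽₂ (`sub_smul_p_mem_hit`).

The finite verifications are Boolean computations on lists of exponent vectors, each backed by a
lemma that interprets its outcome. -/

/-! ### Steenrod squares over a field of characteristic two, possibly twisted -/

section TotalSquare

variable (K : Type*) [Field K]

/-- The variable whose square is added to `x_j` by the total square: `x_j` itself, or its cyclic
predecessor in the twisted case. -/
def squareSource (tw : Bool) (j : Fin 5) : Fin 5 := bif tw then j + 4 else j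

/-- The total Steenrod square over `K`, or its cyclically twisted form
`y_j ↦ y_j + y_{j-1}² t`. -/
def totalSqOver (tw : Bool) :
    MvPolynomial (Fin 5) K →ₐ[K] Polynomial (MvPolynomial (Fin 5) K) :=
  aeval fun j => Polynomial.C (X j) + Polynomial.C (X (squareSource tw j) ^ 2) * Polynomial.X

/-- The span of the images of the (twisted) squares of positive degree. -/
def hits (tw : Bool) : Submodule K (MvPolynomial (Fin 5) K) :=
  Submodule.span K {h | ∃ i f, 0 < i ∧ (totalSqOver K tw f).coeff i = h}

variable {K}

theorem coeff_totalSqOver_mem_hits {tw : Bool} {i : ℕ} (hi : 0 < i)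
    (f : MvPolynomial (Fin 5) K) : (totalSqOver K tw f).coeff i ∈ hits K tw :=
  Submodule.subset_span ⟨i, f, hi, rfl⟩

theorem totalSq_eq_totalSqOver : totalSq 5 = totalSqOver (ZMod 2) false := rfl

/-- For a product, ab·f - ε(a)ε(b)f = (a(bf) - ε(a)bf) + ε(a)(bf - ε(b)f). The induction thus never
needs the span of the images of the squares to be stable under the squares. -/
theorem action_sub_augmentation_mem (u : FreeAlgebra (ZMod 2) ℕ) (f : Poly 5) :
    action 5 (RingQuot.mkAlgHom (ZMod 2) AdemRel u) f -
      augmentation (RingQuot.mkAlgHom (ZMod 2) AdemRel u) • f ∈ hits (ZMod 2) false := by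
  rw [action, augmentation, RingQuot.liftAlgHom_mkAlgHom_apply,
    RingQuot.liftAlgHom_mkAlgHom_apply]
  induction u using FreeAlgebra.induction generalizing f with
  | grade0 c => simp [Module.algebraMap_end_apply]
  | grade1 i =>
    rcases Nat.eq_zero_or_pos i with rfl | hi
    · simp [sq_zero]
    · simpa [hi.ne', sq_apply, totalSq_eq_totalSqOver] using coeff_totalSqOver_mem_hits hi f
  | mul a b ha hb =>
    simp only [map_mul, Module.End.mul_apply]
    convert add_mem (ha (FreeAlgebra.lift (ZMod 2) (Sq 5) b f))
      (Submodule.smul_mem _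
        (FreeAlgebra.lift (ZMod 2) (fun i => if i = 0 then (1 : ZMod 2) else 0) a) (hb f)) using 1
    rw [smul_sub, smul_smul]
    abel
  | add a b ha hb =>
    simp only [map_add, LinearMap.add_apply, add_smul]
    convert add_mem (ha f) (hb f) using 1
    abel

/-- This replaces the whole augmentation ideal by single squares of positive degree, the form in
which hit polynomials are produced and tested below. -/
theorem hit_eq_hits : hit 5 = hits (ZMod 2) false := by
  refine le_antisymm (Submodule.span_le.2 ?_) (Submodule.span_le.2 ?_)
  · rintro _ ⟨θ, f, hθ, rfl⟩
    obtain ⟨u, rfl⟩ := RingQuot.mkAlgHom_surjective (ZMod 2) AdemRel θ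
    simpa [hθ] using action_sub_augmentation_mem u f
  · rintro _ ⟨i, f, hi, rfl⟩
    refine Submodule.subset_span
      ⟨RingQuot.mkAlgHom (ZMod 2) AdemRel (FreeAlgebra.ι (ZMod 2) i), f, ?_, ?_⟩
    · simp [augmentation, RingQuot.liftAlgHom_mkAlgHom_apply, hi.ne']
    · simp [action, RingQuot.liftAlgHom_mkAlgHom_apply, sq_apply, totalSq_eq_totalSqOver]

/-- A homomorphism which commutes with the total squares preserves hit polynomials. -/
theorem map_mem_hits {tw tw' : Bool} (A : MvPolynomial (Fin 5) K →ₐ[K] MvPolynomial (Fin 5) K)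
    (hA : ∀ j, totalSqOver K tw' (A (X j)) = (totalSqOver K tw (X j)).map (A : _ →+* _))
    {f : MvPolynomial (Fin 5) K} (hf : f ∈ hits K tw) : A f ∈ hits K tw' := by
  have key : (totalSqOver K tw').comp A = (Polynomial.mapAlgHom A).comp (totalSqOver K tw) :=
    MvPolynomial.algHom_ext fun j => hA j
  refine (Submodule.span_le (p := (hits K tw').comap A.toLinearMap)).2 ?_ hf
  rintro _ ⟨i, f, hi, rfl⟩
  have h := congrArg (fun q => Polynomial.coeff q i) (DFunLike.congr_fun key f)
  simp only [AlgHom.comp_apply, Polynomial.coe_mapAlgHom, Polynomial.coeff_map] at h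
  change A ((totalSqOver K tw f).coeff i) ∈ hits K tw'
  have h' : (totalSqOver K tw' (A f)).coeff i = A ((totalSqOver K tw f).coeff i) := h
  exact h' ▸ coeff_totalSqOver_mem_hits hi (A f)

theorem totalSqOver_X (tw : Bool) (j : Fin 5) : totalSqOver K tw (X j) =
    Polynomial.C (X j) + Polynomial.C (X (squareSource tw j) ^ 2) * Polynomial.X := by
  simp [totalSqOver]

end TotalSquare

/-! ### Monomials -/

/-- An exponent vector in five variables. -/
structure Expo where
  (a b c d e : ℕ)

namespace Expo

def deg (m : Expo) : ℕ := m.a + m.b + m.c + m.d + m.e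

/-- The exponent vector as a finitely supported function. -/
def toFinsupp (m : Expo) : Fin 5 →₀ ℕ := Finsupp.equivFunOnFinite.symm ![m.a, m.b, m.c, m.d, m.e]

def ofFinsupp (s : Fin 5 →₀ ℕ) : Expo := ⟨s 0, s 1, s 2, s 3, s 4⟩

theorem toFinsupp_ofFinsupp (s : Fin 5 →₀ ℕ) : (ofFinsupp s).toFinsupp = s := by
  ext i
  fin_cases i <;> rfl

theorem ofFinsupp_toFinsupp (m : Expo) : ofFinsupp m.toFinsupp = m := rfl

theorem toFinsupp_injective : Function.Injective toFinsupp :=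
  Function.LeftInverse.injective ofFinsupp_toFinsupp

/-- The monomial with the given exponents. -/
def mono (K : Type*) [CommSemiring K] (m : Expo) : MvPolynomial (Fin 5) K :=
  X 0 ^ m.a * X 1 ^ m.b * X 2 ^ m.c * X 3 ^ m.d * X 4 ^ m.e

theorem mono_eq_monomial (K : Type*) [CommSemiring K] (m : Expo) :
    m.mono K = monomial m.toFinsupp 1 := by
  rw [monomial_eq, Finsupp.prod_fintype _ _ (by simp)]
  simp [mono, Fin.prod_univ_five, toFinsupp]

theorem monomial_eq_mono (K : Type*) [CommSemiring K] (s : Fin 5 →₀ ℕ) :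
    monomial s (1 : K) = (ofFinsupp s).mono K := by
  rw [mono_eq_monomial, toFinsupp_ofFinsupp]

end Expo

/-- The sum of the monomials with exponents in a list. -/
def monoSum (K : Type*) [CommSemiring K] (L : List Expo) : MvPolynomial (Fin 5) K :=
  (L.map (Expo.mono K)).sum

/-- Every linear condition on polynomials can be checked on monomials. -/
theorem mem_of_mono_mem {K : Type*} [Field K] (S : Submodule K (MvPolynomial (Fin 5) K))
    (f : MvPolynomial (Fin 5) K)
    (h : ∀ m : Expo, m.toFinsupp ∈ f.support → m.mono K ∈ S) : f ∈ S := by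
  rw [f.as_sum]
  refine Submodule.sum_mem _ fun s hs => ?_
  have e : monomial s (coeff s f) = coeff s f • (Expo.ofFinsupp s).mono K := by
    rw [← Expo.monomial_eq_mono, smul_monomial, smul_eq_mul, mul_one]
  rw [e]
  exact S.smul_mem _ (h _ (by rwa [Expo.toFinsupp_ofFinsupp]))

/-! ### Lists of the terms of squares -/

/-- The recursor of lists, used for definitions that have to be evaluated. -/
def listRec {α β : Type} (z : β) (f : α → List α → β → β) (l : List α) : β :=
  @List.rec α (fun _ => β) z f l

def oddChoose (n : ℕ) : List ℕ := (List.range (n + 1)).filter fun k => n.choose k % 2 == 1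

def oddChooseTable : List (List ℕ) :=
  [[0], [0, 1], [0, 2], [0, 1, 2, 3], [0, 4], [0, 1, 4, 5], [0, 2, 4, 6], [0, 1, 2, 3, 4, 5, 6, 7],
    [0, 8], [0, 1, 8, 9], [0, 2, 8, 10], [0, 1, 2, 3, 8, 9, 10, 11], [0, 4, 8, 12],
    [0, 1, 4, 5, 8, 9, 12, 13], [0, 2, 4, 6, 8, 10, 12, 14],
    [0, 1, 2, 3, 4, 5, 6, 7, 8, 9, 10, 11, 12, 13, 14, 15]]

/-- The `k` with odd binomial coefficient `n.choose k`, looked up in a table if `n < 16`. -/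
def odds (n : ℕ) : List ℕ :=
  listRec (fun n => oddChoose (n + 16))
    (fun x _ ih n => @Nat.rec (fun _ => List ℕ) x (fun n _ => ih n) n) oddChooseTable n

theorem odds_eq : ∀ n, odds n = oddChoose n
  | 0 | 1 | 2 | 3 | 4 | 5 | 6 | 7 | 8 | 9 | 10 | 11 | 12 | 13 | 14 | 15 => by decide +kernel
  | _ + 16 => rfl

/-- Concatenation of lists over the odd binomial coefficients `n.choose k` with `k ≤ i`. -/
def oddLoop {α : Type} (n i : ℕ) (f : ℕ → List α → List α) (r : List α) : List α :=
  listRec r (fun k _ ih => cond (Nat.ble k i) (f k ih) ih) (odds n)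

/-- The list of all `emit k₀ k₁ k₂ k₃ k₄` with `∑ kⱼ = i` and odd binomial coefficients, put in
front of the list `r`. -/
def squareList {α : Type} (m : Expo) (i : ℕ) (emit : ℕ → ℕ → ℕ → ℕ → ℕ → α) (r : List α) :
    List α :=
  oddLoop m.a i (fun k₀ => oddLoop m.b (Nat.sub i k₀) fun k₁ =>
    oddLoop m.c (Nat.sub (Nat.sub i k₀) k₁) fun k₂ =>
    oddLoop m.d (Nat.sub (Nat.sub (Nat.sub i k₀) k₁) k₂) fun k₃ =>
    oddLoop m.e (Nat.sub (Nat.sub (Nat.sub (Nat.sub i k₀) k₁) k₂) k₃) fun k₄ r =>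
      cond (Nat.beq k₄ (Nat.sub (Nat.sub (Nat.sub (Nat.sub i k₀) k₁) k₂) k₃))
        (emit k₀ k₁ k₂ k₃ k₄ :: r) r) r

section Sum

variable {α M : Type*} [AddCommMonoid M]

theorem sum_oddLoop {α : Type} (g : α → M) (n i : ℕ) (f : ℕ → List α → List α) (F : ℕ → M)
    (hf : ∀ k r, k ≤ n → k ≤ i → ((f k r).map g).sum = F k + (r.map g).sum) (r : List α) :
    ((oddLoop n i f r).map g).sum =
      ((odds n).map fun k => if k ≤ i then F k else 0).sum + (r.map g).sum := by
  have hle : ∀ k ∈ odds n, k ≤ n := by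
    intro k hk
    rw [odds_eq, oddChoose, List.mem_filter, List.mem_range] at hk
    omega
  unfold oddLoop
  generalize odds n = l at hle
  induction l with
  | nil => simp [listRec]
  | cons k l ih =>
    have ih' := ih fun k hk => hle k (List.mem_cons_of_mem _ hk)
    simp only [listRec] at ih' ⊢
    by_cases h : k ≤ i
    · rw [show Nat.ble k i = true from Nat.ble_eq_true_of_le h, cond_true,
        hf _ _ (hle k List.mem_cons_self) h, ih']
      simp [h, add_assoc]
    · rw [show Nat.ble k i = false from Bool.eq_false_iff.2 fun e => h (Nat.le_of_ble_eq_true e),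
        cond_false, ih']
      simp [h]

theorem sum_map_filter {β : Type*} (p : β → Bool) (g : β → M) (l : List β) :
    ((l.filter p).map g).sum = (l.map fun k => if p k then g k else 0).sum := by
  induction l with
  | nil => rfl
  | cons k l ih => by_cases h : p k <;> simp [h, ih]

end Sum

/-! ### Squares of monomials as lists of terms -/

section Expansion

variable {K : Type*} [Field K] [CharP K 2]

/-- In the binomial expansion only the odd coefficients survive in characteristic two, and they
become 1. -/
theorem add_C_mul_X_pow {R : Type*} [CommRing R] [CharP R 2] (x z : R) (n : ℕ) :
    (Polynomial.C x + Polynomial.C z * Polynomial.X) ^ n =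
      ((odds n).map fun k => Polynomial.C (x ^ (n - k) * z ^ k) * Polynomial.X ^ k).sum := by
  rw [add_comm, add_pow, odds_eq, oddChoose, sum_map_filter, Finset.sum_eq_multiset_sum,
    Finset.range_val, Multiset.range, Multiset.map_coe, Multiset.sum_coe]
  congr 1
  refine List.map_congr_left fun k _ => ?_
  rcases Nat.mod_two_eq_zero_or_one (n.choose k) with h | h
  · have h0 : ((n.choose k : ℕ) : Polynomial R) = 0 :=
      (CharP.cast_eq_zero_iff (Polynomial R) 2 _).2 (Nat.dvd_of_mod_eq_zero h)
    simp [h, h0]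
  · have h1 : ((n.choose k : ℕ) : Polynomial R) = 1 := by
      rw [← Nat.mod_add_div (n.choose k) 2, h]
      push_cast
      rw [CharTwo.two_eq_zero, zero_mul, add_zero]
    simp only [h, h1, beq_self_eq_true, if_true, map_mul, map_pow]
    ring

theorem coeff_sum_mul {R : Type*} [CommRing R] (l : List ℕ) (w : ℕ → R) (Q : Polynomial R)
    (i : ℕ) : ((l.map fun k => Polynomial.C (w k) * Polynomial.X ^ k).sum * Q).coeff i =
      (l.map fun k => if k ≤ i then w k * Q.coeff (i - k) else 0).sum := by
  induction l with
  | nil => simp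
  | cons k l ih =>
    simp only [List.map_cons, List.sum_cons, add_mul, Polynomial.coeff_add, ih, mul_assoc,
      Polynomial.coeff_C_mul, Polynomial.coeff_X_pow_mul', mul_ite, mul_zero]

theorem sum_oddLoop_mul {R : Type*} [CommRing R] {α : Type} (g : α → R) (n i : ℕ)
    (f : ℕ → List α → List α) (c : R) (w Q : ℕ → R)
    (hf : ∀ k r, k ≤ n → k ≤ i → ((f k r).map g).sum = c * w k * Q k + (r.map g).sum) (r : List α) :
    ((oddLoop n i f r).map g).sum =
      c * ((odds n).map fun k => if k ≤ i then w k * Q k else 0).sum + (r.map g).sum := by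
  rw [sum_oddLoop g n i f (fun k => c * w k * Q k) hf, ← List.sum_map_mul_left]
  simp only [mul_ite, mul_zero, mul_assoc]

/-- The terms of a square of a monomial. -/
theorem sum_squareList {α : Type} (tw : Bool) (m : Expo) (i : ℕ)
    (emit : ℕ → ℕ → ℕ → ℕ → ℕ → α) (g : α → MvPolynomial (Fin 5) K)
    (hg : ∀ k₀ k₁ k₂ k₃ k₄, k₀ ≤ m.a → k₁ ≤ m.b → k₂ ≤ m.c → k₃ ≤ m.d → k₄ ≤ m.e →
      g (emit k₀ k₁ k₂ k₃ k₄) =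
        X 0 ^ (m.a - k₀) * (X (squareSource tw 0) ^ 2) ^ k₀ *
        (X 1 ^ (m.b - k₁) * (X (squareSource tw 1) ^ 2) ^ k₁ *
        (X 2 ^ (m.c - k₂) * (X (squareSource tw 2) ^ 2) ^ k₂ *
        (X 3 ^ (m.d - k₃) * (X (squareSource tw 3) ^ 2) ^ k₃ *
        (X 4 ^ (m.e - k₄) * (X (squareSource tw 4) ^ 2) ^ k₄)))))
    (r : List α) :
    ((squareList m i emit r).map g).sum =
      (totalSqOver K tw (m.mono K)).coeff i + (r.map g).sum := by
  have hT : totalSqOver K tw (m.mono K) =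
      (totalSqOver K tw (X 0)) ^ m.a * ((totalSqOver K tw (X 1)) ^ m.b *
      ((totalSqOver K tw (X 2)) ^ m.c * ((totalSqOver K tw (X 3)) ^ m.d *
      ((totalSqOver K tw (X 4)) ^ m.e * 1)))) := by
    simp only [Expo.mono, map_mul, map_pow, mul_assoc, mul_one]
  rw [hT]
  simp only [totalSqOver_X, add_C_mul_X_pow, coeff_sum_mul, Polynomial.coeff_one]
  unfold squareList
  -- The factor 1 starts the accumulator `c` of `sum_oddLoop_mul`, which collects the factors of the
  -- outer variables while the five loops are opened.
  rw [← one_mul (List.sum (List.map (fun k => if k ≤ i then _ else 0) (odds m.a)))]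
  refine sum_oddLoop_mul g _ _ _ _ _ _ (fun k₀ r h₀ _ => ?_) r
  refine sum_oddLoop_mul g _ _ _ _ _ _ (fun k₁ r h₁ _ => ?_) r
  refine sum_oddLoop_mul g _ _ _ _ _ _ (fun k₂ r h₂ _ => ?_) r
  refine sum_oddLoop_mul g _ _ _ _ _ _ (fun k₃ r h₃ _ => ?_) r
  simp only [Nat.sub_eq]
  -- What remains after the fifth factor is the polynomial 1, whose coefficient is nonzero only when
  -- the whole degree `i` has been used up.
  refine sum_oddLoop_mul g _ _ _ _ _
    (fun k => if i - k₀ - k₁ - k₂ - k₃ - k = 0 then 1 else 0) (fun k₄ r h₄ hi => ?_) r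
  by_cases h : k₄ = i - k₀ - k₁ - k₂ - k₃
  · rw [show Nat.beq k₄ (i - k₀ - k₁ - k₂ - k₃) = true from h ▸ Nat.beq_refl _, cond_true,
      List.map_cons, List.sum_cons, hg _ _ _ _ _ h₀ h₁ h₂ h₃ h₄, if_pos (by omega)]
    ring
  · rw [show Nat.beq k₄ (i - k₀ - k₁ - k₂ - k₃) = false from
      Bool.eq_false_iff.2 fun e => h (Nat.eq_of_beq_eq_true e), cond_false, if_neg (by omega)]
    ring

end Expansion

end SteenrodHit

end

noncomputable section

namespace SteenrodHit

open MvPolynomial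

/-! ### Cancellation of equal terms in lists -/

/-- Merging of two sorted lists in which equal entries cancel. -/
def mergeCancel (l₁ : List ℕ) : List ℕ → List ℕ :=
  listRec (fun l₂ => l₂) (fun x xs ihx l₂ => listRec (x :: xs) (fun y ys ihy =>
    cond (Nat.ble x y) (cond (Nat.beq x y) (ihx ys) (x :: ihx (y :: ys))) (y :: ihy)) l₂) l₁

/-- The second argument carries at most one list that waits for a partner; a list left over at the
end passes unmerged to the next round. -/
def mergePairs (L : List (List ℕ)) : List (List ℕ) → List (List ℕ) :=
  listRec (fun c => c) (fun x _ ih c =>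
    listRec (ih [x]) (fun y _ _ => mergeCancel x y :: ih []) c) L

/-- Merging of lists in `n` rounds. -/
def mergeAll (n : ℕ) (L : List (List ℕ)) : List ℕ :=
  @Nat.rec (fun _ => List (List ℕ) → List ℕ) (fun L => L.flatten)
    (fun _ ih L => ih (mergePairs L [])) n L

section Merge

variable {M : Type*} [AddCommMonoid M]

theorem sum_mergeCancel (g : ℕ → M) (hg : ∀ x, g x + g x = 0)
    (l₁ l₂ : List ℕ) :
    ((mergeCancel l₁ l₂).map g).sum = (l₁.map g).sum + (l₂.map g).sum := by
  induction l₁ generalizing l₂ with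
  | nil => simp [mergeCancel, listRec]
  | cons x xs ihx =>
    induction l₂ with
    | nil => simp [mergeCancel, listRec]
    | cons y ys ihy =>
      have e : mergeCancel (x :: xs) (y :: ys) = cond (Nat.ble x y) (cond (Nat.beq x y)
        (mergeCancel xs ys) (x :: mergeCancel xs (y :: ys))) (y :: mergeCancel (x :: xs) ys) := rfl
      rw [e]
      cases Nat.ble x y with
      | false =>
        simp only [cond_false, List.map_cons, List.sum_cons] at ihy ⊢
        rw [ihy]
        abel
      | true =>
        cases hxy : Nat.beq x y with
        | false =>
          simp only [cond_true, cond_false, List.map_cons, List.sum_cons, ihx]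
          abel
        | true =>
          obtain rfl := Nat.eq_of_beq_eq_true hxy
          simp only [cond_true, List.map_cons, List.sum_cons, ihx]
          rw [show g x + (xs.map g).sum + (g x + (ys.map g).sum) =
            g x + g x + ((xs.map g).sum + (ys.map g).sum) by abel, hg, zero_add]

theorem sum_mergePairs (g : ℕ → M) (hg : ∀ x, g x + g x = 0)
    (L c : List (List ℕ)) (hc : c.length ≤ 1) :
    ((mergePairs L c).map fun l => (l.map g).sum).sum =
      (c.map fun l => (l.map g).sum).sum + (L.map fun l => (l.map g).sum).sum := by
  induction L generalizing c with
  | nil => simp [mergePairs, listRec]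
  | cons x xs ih =>
    match c with
    | [] =>
      have e : mergePairs (x :: xs) [] = mergePairs xs [x] := rfl
      rw [e, ih _ (by simp)]
      simp
    | [y] =>
      have e : mergePairs (x :: xs) [y] = mergeCancel x y :: mergePairs xs [] := rfl
      rw [e, List.map_cons, List.sum_cons, ih _ (by simp), sum_mergeCancel g hg]
      simp only [List.map_cons, List.sum_cons, List.map_nil, List.sum_nil]
      abel
    | _ :: _ :: _ => simp at hc

/-- The sum is preserved for every number of rounds and for unsorted lists too. Sorting and enough
rounds matter only for the cancellation to be complete. -/
theorem sum_mergeAll (g : ℕ → M) (hg : ∀ x, g x + g x = 0)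
    (n : ℕ) (L : List (List ℕ)) :
    ((mergeAll n L).map g).sum = (L.map fun l => (l.map g).sum).sum := by
  induction n generalizing L with
  | zero =>
    change (L.flatten.map g).sum = _
    induction L with
    | nil => rfl
    | cons l L ih =>
      rw [List.flatten_cons, List.map_append, List.sum_append, ih, List.map_cons, List.sum_cons]
  | succ n ih =>
    have e : mergeAll (n + 1) L = mergeAll n (mergePairs L []) := rfl
    rw [e, ih, sum_mergePairs g hg _ _ (by simp)]
    simp

end Merge

/-! ### Certificates for hit polynomials -/

namespace Expo

/-- The exponent vector whose entries are the last five hexadecimal digits. -/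
def ofHex (k : ℕ) : Expo :=
  ⟨k / 65536 % 16, k / 4096 % 16, k / 256 % 16, k / 16 % 16, k % 16⟩

/-- The exponent vector as the digits of a number in base 64. -/
def pack (m : Expo) : ℕ :=
  Nat.add (Nat.mul 16777216 m.a) (Nat.add (Nat.mul 262144 m.b)
    (Nat.add (Nat.mul 4096 m.c) (Nat.add (Nat.mul 64 m.d) m.e)))

def unpack (n : ℕ) : Expo :=
  ⟨n / 16777216, n / 262144 % 64, n / 4096 % 64, n / 64 % 64, n % 64⟩

theorem unpack_pack (m : Expo) (hb : m.b < 64) (hc : m.c < 64) (hd : m.d < 64) (he : m.e < 64) :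
    unpack m.pack = m := by
  obtain ⟨a, b, c, d, e⟩ := m
  simp only [unpack, pack, mk.injEq, Nat.add_eq, Nat.mul_eq] at *
  omega

/-- The exponents of the term of a square of the monomial `m` in which `kⱼ` of the factors
`x_j` are squared. -/
def shift (tw : Bool) (m : Expo) (k₀ k₁ k₂ k₃ k₄ : ℕ) : Expo :=
  cond tw ⟨m.a - k₀ + 2 * k₁, m.b - k₁ + 2 * k₂, m.c - k₂ + 2 * k₃, m.d - k₃ + 2 * k₄,
      m.e - k₄ + 2 * k₀⟩
    ⟨m.a + k₀, m.b + k₁, m.c + k₂, m.d + k₃, m.e + k₄⟩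

theorem mono_shift (K : Type*) [CommSemiring K] (tw : Bool) (m : Expo) (k₀ k₁ k₂ k₃ k₄ : ℕ)
    (h₀ : k₀ ≤ m.a) (h₁ : k₁ ≤ m.b) (h₂ : k₂ ≤ m.c) (h₃ : k₃ ≤ m.d) (h₄ : k₄ ≤ m.e) :
    (m.shift tw k₀ k₁ k₂ k₃ k₄).mono K =
      X 0 ^ (m.a - k₀) * (X (squareSource tw 0) ^ 2) ^ k₀ *
      (X 1 ^ (m.b - k₁) * (X (squareSource tw 1) ^ 2) ^ k₁ *
      (X 2 ^ (m.c - k₂) * (X (squareSource tw 2) ^ 2) ^ k₂ *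
      (X 3 ^ (m.d - k₃) * (X (squareSource tw 3) ^ 2) ^ k₃ *
      (X 4 ^ (m.e - k₄) * (X (squareSource tw 4) ^ 2) ^ k₄)))) := by
  cases tw with
  | true =>
    simp only [shift, mono, cond_true, squareSource, show (0 : Fin 5) + 4 = 4 from rfl,
      show (1 : Fin 5) + 4 = 0 from rfl, show (2 : Fin 5) + 4 = 1 from rfl,
      show (3 : Fin 5) + 4 = 2 from rfl, show (4 : Fin 5) + 4 = 3 from rfl, pow_add, pow_mul]
    ring
  | false =>
    simp only [shift, mono, cond_false, squareSource, ← pow_mul, ← pow_add]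
    rw [show m.a - k₀ + 2 * k₀ = m.a + k₀ by omega, show m.b - k₁ + 2 * k₁ = m.b + k₁ by omega,
      show m.c - k₂ + 2 * k₂ = m.c + k₂ by omega, show m.d - k₃ + 2 * k₃ = m.d + k₃ by omega,
      show m.e - k₄ + 2 * k₄ = m.e + k₄ by omega]
    ring

end Expo

/-- The terms of the square with values in degree 20 of a monomial of lower degree. -/
def packedTerms (h : ℕ) : List ℕ :=
  cond (Nat.ble 20 (Expo.ofHex h).deg) []
    (squareList (Expo.ofHex h) (Nat.sub 20 (Expo.ofHex h).deg) (fun k₀ k₁ k₂ k₃ k₄ =>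
      Nat.add (Expo.ofHex h).pack (Expo.pack ⟨k₀, k₁, k₂, k₃, k₄⟩)) [])

/-- The sum of the monomials with packed exponents in a list. -/
def packedSum (L : List ℕ) : Poly 5 := (L.map fun n => (Expo.unpack n).mono (ZMod 2)).sum

theorem packedSum_packedTerms_mem (h : ℕ) :
    packedSum (packedTerms h) ∈ hits (ZMod 2) false := by
  unfold packedTerms
  cases hd : Nat.ble 20 (Expo.ofHex h).deg with
  | true => simp [packedSum]
  | false =>
    have hlt : ¬ 20 ≤ (Expo.ofHex h).deg := fun e => by
      rw [Nat.ble_eq_true_of_le e] at hd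
      cases hd
    rw [cond_false, packedSum, sum_squareList false]
    · simpa using coeff_totalSqOver_mem_hits (Nat.sub_pos_of_lt (not_le.1 hlt)) _
    · intro k₀ k₁ k₂ k₃ k₄ h₀ h₁ h₂ h₃ h₄
      rw [← Expo.mono_shift (ZMod 2) false _ _ _ _ _ _ h₀ h₁ h₂ h₃ h₄]
      congr 1
      -- Packing is additive as long as no digit overflows: the exponents are hexadecimal digits and
      -- at most double, so they stay below 64.
      rw [← Expo.unpack_pack (Expo.shift _ _ _ _ _ _ _)]
      · congr 1
        simp only [Expo.pack, Expo.shift, cond_false, Nat.add_eq, Nat.mul_eq]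
        ring
      all_goals
        simp only [Expo.shift, cond_false, Expo.ofHex] at *
        omega

/-- If the terms of the squares in the list `c` cancel the terms of `T`, then `T` is hit. -/
theorem packedSum_mem_hits (T c : List ℕ)
    (h : (mergeAll 11 (c.map packedTerms ++ T.map fun x => [x])).isEmpty = true) :
    packedSum T ∈ hits (ZMod 2) false := by
  have h2 := sum_mergeAll (fun n => (Expo.unpack n).mono (ZMod 2))
    (fun x => CharTwo.add_self_eq_zero _) 11 (c.map packedTerms ++ T.map fun x => [x])
  rw [List.isEmpty_iff.1 h, List.map_append, List.sum_append, List.map_map, List.map_map] at h2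
  have h3 : (T.map ((fun l => (l.map fun n => (Expo.unpack n).mono (ZMod 2)).sum) ∘
      fun x => [x])).sum = packedSum T := by
    rw [packedSum]
    congr 1
    exact List.map_congr_left fun x _ => by simp
  rw [h3, List.map_nil, List.sum_nil] at h2
  rw [← CharTwo.add_eq_zero.1 h2.symm]
  refine list_sum_mem fun q hq => ?_
  obtain ⟨x, _, rfl⟩ := List.mem_map.1 hq
  exact packedSum_packedTerms_mem x

end SteenrodHit

end

noncomputable section

namespace SteenrodHit

open MvPolynomial

/-! ### The class of `p` is invariant -/

/-- The exponents of the monomials of `p`. -/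
def pExpos : List ℕ :=
  [0x1133c, 0x1135a, 0x11369, 0x113c3, 0x11639, 0x11693, 0x1313c, 0x1315a, 0x13169, 0x131c3,
   0x13349, 0x13358, 0x13538, 0x13583, 0x16139, 0x16193, 0x31439, 0x31493, 0x31538, 0x31583,
   0x34139, 0x34193, 0x35138, 0x35183, 0x13556, 0x13565, 0x13655, 0x16355, 0x31556, 0x31565,
   0x35156, 0x35165, 0x33455, 0x33545, 0x33554, 0x34355, 0x35345, 0x35354, 0x35534, 0x35543]

/-- Each entry encodes a monomial in its hexadecimal digits. Its degree d determines the square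
applied to it, namely Sq^(20-d). -/
def swapCertificate₀ : List ℕ :=
  [0x1114c, 0x11188, 0x111a6, 0x1123c, 0x11269, 0x11296, 0x112c3, 0x11386, 0x114a3, 0x11656,
   0x122a4, 0x13159, 0x13195, 0x13249, 0x13258, 0x132a3, 0x13438, 0x13456, 0x13555, 0x14158,
   0x14194, 0x15139, 0x15148, 0x15193, 0x15238, 0x15355, 0x15445, 0x15454, 0x16228, 0x16246,
   0x16426, 0x16624, 0x17164, 0x17434, 0x19234, 0x2313a, 0x23365, 0x31159, 0x31168, 0x31186,
   0x31195, 0x31285, 0x312a3, 0x31438, 0x31528, 0x31546, 0x31555, 0x31825, 0x31843, 0x3213a,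
   0x32158, 0x32365, 0x32626, 0x33148, 0x33256, 0x33265, 0x33283, 0x33346, 0x33364, 0x33634,
   0x33643, 0x34156, 0x34525, 0x34543, 0x36244, 0x41194, 0x47134, 0x51139, 0x51148, 0x51193,
   0x51238, 0x51355, 0x51454, 0x52228, 0x52426, 0x52624, 0x54244, 0x61156, 0x61525, 0x61543,
   0x71164, 0x71434, 0x74134, 0x91234, 0x1113c, 0x1115a, 0x1124a, 0x11286, 0x112a4, 0x11385,
   0x11565, 0x11826, 0x12159, 0x12168, 0x12195, 0x12258, 0x12285, 0x122a3, 0x12456, 0x12555,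
   0x1313a, 0x13149, 0x13158, 0x131a3, 0x13239, 0x13284, 0x13293, 0x13356, 0x13365, 0x13446,
   0x13455, 0x14238, 0x15156, 0x15525, 0x15543, 0x16128, 0x16245, 0x17154, 0x17244, 0x21159,
   0x21186, 0x21195, 0x21285, 0x212a3, 0x21555, 0x21825, 0x21843, 0x2213a, 0x22365, 0x23139,
   0x23184, 0x23193, 0x23238, 0x23355, 0x23445, 0x24138, 0x24165, 0x24183, 0x24345, 0x24354,
   0x24525, 0x24534, 0x25254, 0x27144, 0x27234, 0x28134, 0x3113a, 0x31149, 0x311a3, 0x31239,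
   0x31248, 0x31266, 0x31284, 0x31293, 0x31356, 0x31365, 0x31446, 0x31455, 0x31626, 0x31644,
   0x32139, 0x32166, 0x32193, 0x32238, 0x32256, 0x32355, 0x32445, 0x32454, 0x32526, 0x32544,
   0x32625, 0x32643, 0x33138, 0x33156, 0x33165, 0x33183, 0x33345, 0x33354, 0x33534, 0x33543,
   0x34164, 0x34245, 0x41238, 0x41526, 0x43254, 0x52164, 0x61128, 0x71154, 0x71244, 0x72144,
   0x72234, 0x82134, 0x11446, 0x13156, 0x13264, 0x13345, 0x14245, 0x15154, 0x16234, 0x25144,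
   0x31156, 0x31246, 0x31264, 0x31345, 0x32245, 0x51154, 0x52144, 0x61234, 0x81124, 0x11424,
   0x13323, 0x14124, 0x31323]

def swapCertificate₁ : List ℕ :=
  [0x14428, 0x23338, 0x23383, 0x23455, 0x24346, 0x24355, 0x24463, 0x26443, 0x28441, 0x28522,
   0x13338, 0x13356, 0x13365, 0x13383, 0x14328, 0x14382, 0x14436, 0x14463, 0x14724, 0x14742,
   0x15822, 0x18522, 0x13444, 0x13822, 0x14281, 0x14524, 0x14542, 0x18241]

def swapCertificate₂ : List ℕ :=
  [0x11296, 0x1134a, 0x11359, 0x1143a, 0x11458, 0x11539, 0x11665, 0x11764, 0x11836, 0x11926,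
   0x12196, 0x1222c, 0x122a4, 0x12358, 0x12394, 0x123a3, 0x12538, 0x12556, 0x12835, 0x12916,
   0x12a33, 0x12a42, 0x13159, 0x13186, 0x13195, 0x13249, 0x13258, 0x132a3, 0x13348, 0x13429,
   0x13465, 0x13483, 0x13519, 0x13528, 0x13816, 0x13843, 0x13915, 0x13a23, 0x14194, 0x141a3,
   0x14239, 0x14329, 0x14338, 0x14365, 0x14383, 0x14419, 0x14455, 0x14518, 0x14653, 0x14734,
   0x14914, 0x14a13, 0x15139, 0x15193, 0x15229, 0x15238, 0x15319, 0x15328, 0x15913, 0x16129,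
   0x16156, 0x16219, 0x16246, 0x16282, 0x16435, 0x16453, 0x16516, 0x16543, 0x16822, 0x18415,
   0x18514, 0x18622, 0x19225, 0x19234, 0x19324, 0x1a125, 0x1a134, 0x1a215, 0x1a314, 0x211c3,
   0x21385, 0x21934, 0x21c13, 0x2313a, 0x2331a, 0x24535, 0x2511a, 0x25336, 0x29116, 0x31186,
   0x31258, 0x31456, 0x31465, 0x31618, 0x31825, 0x3211c, 0x32266, 0x32338, 0x32365, 0x32518,
   0x32545, 0x32635, 0x32815, 0x32824, 0x33148, 0x33166, 0x33256, 0x33436, 0x3411a, 0x34129,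
   0x34165, 0x34264, 0x34345, 0x34426, 0x34444, 0x34525, 0x34642, 0x35182, 0x35236, 0x35326,
   0x35344, 0x35434, 0x35452, 0x35542, 0x35812, 0x36145, 0x36154, 0x36163, 0x36424, 0x36514,
   0x36613, 0x38134, 0x38152, 0x38215, 0x38224, 0x38242, 0x38314, 0x38512, 0x3a114, 0x41149,
   0x411a3, 0x41383, 0x41419, 0x41536, 0x41653, 0x41734, 0x41a13, 0x43138, 0x43318, 0x43453,
   0x43516, 0x43543, 0x45118, 0x45253, 0x45523, 0x46135, 0x46315, 0x51148, 0x51229, 0x51355,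
   0x51535, 0x52129, 0x52219, 0x52345, 0x52435, 0x52624, 0x53236, 0x53263, 0x53326, 0x53416,
   0x53425, 0x53623, 0x54145, 0x54262, 0x54622, 0x55135, 0x55144, 0x55153, 0x55225, 0x55315,
   0x55414, 0x55513, 0x56125, 0x56215, 0x56242, 0x56422, 0x58222, 0x6111a, 0x61255, 0x61336,
   0x61525, 0x65116, 0x65134, 0x65152, 0x65314, 0x65512, 0x72118, 0x72145, 0x72262, 0x72415,
   0x73144, 0x73414, 0x75124, 0x75214, 0x81154, 0x11295, 0x11358, 0x11385, 0x11394, 0x113a3,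
   0x11628, 0x11655, 0x11754, 0x11862, 0x11925, 0x11a33, 0x12168, 0x12195, 0x121c2, 0x12258,
   0x12285, 0x12339, 0x12384, 0x12528, 0x12555, 0x12636, 0x12654, 0x12663, 0x12744, 0x12843,
   0x12852, 0x12915, 0x1313a, 0x13149, 0x131a3, 0x13239, 0x13266, 0x13293, 0x1331a, 0x13329,
   0x13419, 0x13455, 0x13626, 0x13923, 0x13a13, 0x14139, 0x14292, 0x14319, 0x14616, 0x14922,
   0x15345, 0x16128, 0x16218, 0x16335, 0x16344, 0x16452, 0x17244, 0x17424, 0x19134, 0x19314,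
   0x211a4, 0x21249, 0x21294, 0x212a3, 0x21339, 0x21366, 0x21384, 0x21483, 0x21555, 0x21645,
   0x21654, 0x21663, 0x21744, 0x21834, 0x21a14, 0x21a23, 0x2211c, 0x221a3, 0x22338, 0x22356,
   0x22383, 0x22653, 0x22734, 0x22a13, 0x23139, 0x23166, 0x23193, 0x23238, 0x23256, 0x23319,
   0x23328, 0x23436, 0x23463, 0x23526, 0x23616, 0x23643, 0x23913, 0x2411a, 0x24129, 0x24138,
   0x24345, 0x24525, 0x24543, 0x25119, 0x25164, 0x25182, 0x25344, 0x25425, 0x25452, 0x25614,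
   0x25812, 0x28215, 0x28512, 0x29115, 0x29124, 0x29214, 0x31149, 0x31185, 0x31248, 0x31266,
   0x31356, 0x31365, 0x31419, 0x31446, 0x31536, 0x31626, 0x31635, 0x31815, 0x3212a, 0x32184,
   0x3221a, 0x32229, 0x32256, 0x32265, 0x32346, 0x32355, 0x32418, 0x32436, 0x32526, 0x32535,
   0x32625, 0x32814, 0x33246, 0x34128, 0x34245, 0x35118, 0x35136, 0x35163, 0x35235, 0x35244,
   0x35253, 0x35262, 0x35316, 0x35325, 0x35415, 0x35523, 0x35613, 0x35622, 0x36126, 0x36135,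
   0x36153, 0x36162, 0x36216, 0x36225, 0x36234, 0x36252, 0x36315, 0x36324, 0x36513, 0x36522,
   0x36612, 0x39114, 0x41616, 0x42165, 0x42453, 0x42516, 0x43416, 0x43434, 0x43542, 0x48132,
   0x53145, 0x53226, 0x53244, 0x61119, 0x61128, 0x61218, 0x61335, 0x61416, 0x61425, 0x62154,
   0x63135, 0x63144, 0x63153, 0x63315, 0x63414, 0x63513, 0x64314, 0x65115, 0x66114, 0x68112,
   0x71118, 0x71145, 0x71226, 0x71415, 0x72144, 0x72414, 0x73224, 0x75114, 0x81126, 0x81162,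
   0x82224, 0x11248, 0x11284, 0x11365, 0x11428, 0x11455, 0x11482, 0x11545, 0x11554, 0x11563,
   0x11635, 0x11644, 0x11653, 0x12148, 0x12445, 0x12922, 0x13156, 0x13228, 0x13264, 0x13453,
   0x13516, 0x13543, 0x13624, 0x14146, 0x14245, 0x14254, 0x14335, 0x14434, 0x14452, 0x14614,
   0x15154, 0x15226, 0x15244, 0x15424, 0x15514, 0x16126, 0x16216, 0x16225, 0x16234, 0x16324,
   0x22246, 0x31246, 0x31345, 0x31426, 0x31435, 0x31453, 0x31543, 0x34126, 0x34135, 0x34144,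
   0x34153, 0x34315, 0x34414, 0x34513, 0x35224, 0x41119, 0x41128, 0x41182, 0x41245, 0x41254,
   0x41335, 0x43135, 0x43153, 0x43315, 0x43513, 0x44314, 0x45115, 0x48112, 0x51118, 0x51145,
   0x51226, 0x51415, 0x52144, 0x52414, 0x53224, 0x55114, 0x12162, 0x31233, 0x31323, 0x33132,
   0x33312]

def swapCertificate₃ : List ℕ :=
  [0x1132c, 0x11386, 0x1152a, 0x11548, 0x11656, 0x11665, 0x11728, 0x11764, 0x11926, 0x11944,
   0x12529, 0x12538, 0x12925, 0x12934, 0x1312c, 0x13186, 0x13429, 0x13438, 0x13456, 0x13465,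
   0x13528, 0x13546, 0x13564, 0x13582, 0x13825, 0x13834, 0x13843, 0x13852, 0x14329, 0x14338,
   0x14356, 0x14365, 0x14428, 0x14725, 0x14734, 0x14824, 0x1512a, 0x15229, 0x16138, 0x16156,
   0x16165, 0x16228, 0x16444, 0x16462, 0x16525, 0x16534, 0x16543, 0x16552, 0x16642, 0x21358,
   0x21394, 0x29125, 0x31456, 0x31465, 0x32356, 0x32365, 0x33256, 0x33265, 0x33634, 0x33643,
   0x34156, 0x34165, 0x34534, 0x34543, 0x34642, 0x41329, 0x41338, 0x41725, 0x41734, 0x43129,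
   0x43138, 0x43525, 0x43552, 0x1122c, 0x1124a, 0x11349, 0x11394, 0x11628, 0x11682, 0x11745,
   0x11754, 0x11862, 0x1212c, 0x1214a, 0x1232a, 0x12528, 0x12582, 0x12654, 0x12726, 0x12834,
   0x12843, 0x12852, 0x13149, 0x1322a, 0x13626, 0x13662, 0x14625, 0x14724, 0x15246, 0x16146,
   0x16344, 0x16425, 0x16524, 0x19125, 0x2132a, 0x21348, 0x21429, 0x21438, 0x21456, 0x21465,
   0x21726, 0x21744, 0x21825, 0x21834, 0x22329, 0x22338, 0x22356, 0x22365, 0x22725, 0x22734,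
   0x2312a, 0x23148, 0x23229, 0x23238, 0x23256, 0x23265, 0x23526, 0x23562, 0x23625, 0x23634,
   0x23643, 0x23652, 0x24129, 0x24138, 0x24156, 0x24165, 0x24525, 0x24543, 0x44532, 0x11356,
   0x11365, 0x11464, 0x11545, 0x11554, 0x11626, 0x11644, 0x12364, 0x12445, 0x12454, 0x12526,
   0x12625, 0x12634, 0x13138, 0x13156, 0x13165, 0x13228, 0x13345, 0x13354, 0x14128, 0x14245,
   0x14344, 0x14524, 0x15145, 0x15226, 0x16126, 0x16225, 0x11424, 0x13323, 0x13332]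

def transvectionCertificate : List ℕ :=
  [0x11296, 0x112a5, 0x1143a, 0x11449, 0x11494, 0x114a3, 0x1215a, 0x121a5, 0x1224a, 0x12268,
   0x12448, 0x12844, 0x1314a, 0x131a4, 0x13249, 0x13294, 0x13438, 0x13456, 0x14086, 0x140a4,
   0x14239, 0x14293, 0x14455, 0x14842, 0x15166, 0x16138, 0x16156, 0x16246, 0x16264, 0x17236,
   0x17245, 0x17254, 0x17434, 0x18028, 0x18136, 0x18442, 0x19045, 0x19054, 0x19144, 0x19234,
   0x2113c, 0x211c3, 0x23158, 0x23185, 0x25183, 0x25435, 0x25453, 0x27163, 0x31438, 0x31456,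
   0x31465, 0x31843, 0x32266, 0x32446, 0x35155, 0x37144, 0x37234, 0x38143, 0x39034, 0x39043,
   0x4113a, 0x411a3, 0x43138, 0x43165, 0x51454, 0x52264, 0x55234, 0x55243, 0x56134, 0x56143,
   0x1223a, 0x12249, 0x12294, 0x122a3, 0x12456, 0x12483, 0x1313a, 0x13185, 0x131a3, 0x13239,
   0x13293, 0x13455, 0x13464, 0x13842, 0x14166, 0x15246, 0x15282, 0x16038, 0x16056, 0x16065,
   0x16074, 0x16146, 0x16155, 0x16164, 0x16182, 0x16236, 0x16245, 0x16263, 0x17028, 0x17046,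
   0x17064, 0x17082, 0x17136, 0x17145, 0x17163, 0x17442, 0x18072, 0x2114a, 0x211a4, 0x2123a,
   0x21294, 0x212a3, 0x21438, 0x21483, 0x21843, 0x2213a, 0x221a3, 0x23148, 0x23166, 0x23238,
   0x23265, 0x24138, 0x24165, 0x25155, 0x27144, 0x27234, 0x28143, 0x29034, 0x29043, 0x31464,
   0x32445, 0x32454, 0x34443, 0x35145, 0x35154, 0x36234, 0x36243, 0x41463, 0x61254, 0x12166,
   0x12256, 0x12265, 0x13165, 0x13255, 0x13444, 0x14083, 0x14092, 0x14245, 0x15028, 0x15082,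
   0x15136, 0x15145, 0x15163, 0x15442, 0x16045, 0x16054, 0x16144, 0x16234, 0x21256, 0x21445,
   0x31444, 0x32443, 0x35134, 0x35143, 0x41254, 0x12144, 0x13233, 0x14142]

theorem p_eq_sum : p = (pExpos.map fun n => (Expo.ofHex n).mono (ZMod 2)).sum := by
  simp only [pExpos, List.map_cons, List.map_nil, List.sum_cons, List.sum_nil, add_zero, p,
    add_assoc]
  rfl

/-- The terms of `p` with the variables `x_s` and `x_{s+1}` exchanged. -/
def swapExpo (s : Fin 4) (m : Expo) : Expo :=
  match s with
  | 0 => ⟨m.b, m.a, m.c, m.d, m.e⟩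
  | 1 => ⟨m.a, m.c, m.b, m.d, m.e⟩
  | 2 => ⟨m.a, m.b, m.d, m.c, m.e⟩
  | 3 => ⟨m.a, m.b, m.c, m.e, m.d⟩

/-- The exponents of the monomials in `m` after the substitution of `x_2 + x_3` for `x_3`. -/
def transvectExpo (m : Expo) : List Expo :=
  (odds m.c).map fun k => ⟨m.a, m.b + k, m.c - k, m.d, m.e⟩

def pPacked : List ℕ := pExpos.map fun n => (Expo.ofHex n).pack

theorem unpack_pack_ofHex (n : ℕ) : Expo.unpack (Expo.ofHex n).pack = Expo.ofHex n :=
  Expo.unpack_pack _ (by simp only [Expo.ofHex]; omega) (by simp only [Expo.ofHex]; omega)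
    (by simp only [Expo.ofHex]; omega) (by simp only [Expo.ofHex]; omega)

theorem packedSum_append (L₁ L₂ : List ℕ) :
    packedSum (L₁ ++ L₂) = packedSum L₁ + packedSum L₂ := by
  simp [packedSum]

theorem packedSum_map_pack (L : List Expo)
    (hL : ∀ m ∈ L, m.b < 64 ∧ m.c < 64 ∧ m.d < 64 ∧ m.e < 64) :
    packedSum (L.map Expo.pack) = monoSum (ZMod 2) L := by
  rw [packedSum, monoSum, List.map_map]
  congr 1
  refine List.map_congr_left fun m hm => ?_
  obtain ⟨h1, h2, h3, h4⟩ := hL m hm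
  simp only [Function.comp_apply, Expo.unpack_pack m h1 h2 h3 h4]

theorem packedSum_pPacked : packedSum pPacked = p := by
  refine Eq.trans ?_ p_eq_sum.symm
  unfold pPacked
  generalize pExpos = l
  rw [packedSum, List.map_map]
  congr 1
  exact List.map_congr_left fun n _ => by simp only [Function.comp_apply, unpack_pack_ofHex]

theorem subst_p_eq (g : Matrix (Fin 5) (Fin 5) (ZMod 2)) (E : Expo → List Expo)
    (hE : ∀ m : Expo, subst 5 g (m.mono (ZMod 2)) = monoSum (ZMod 2) (E m))
    (hb : ∀ n, ∀ m ∈ E (Expo.ofHex n), m.b < 64 ∧ m.c < 64 ∧ m.d < 64 ∧ m.e < 64) :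
    subst 5 g p = packedSum (pExpos.flatMap fun n => (E (Expo.ofHex n)).map Expo.pack) := by
  rw [p_eq_sum]
  generalize pExpos = l
  induction l with
  | nil => simp [packedSum]
  | cons n l ih =>
    rw [List.map_cons, List.sum_cons, map_add, ih, List.flatMap_cons, packedSum_append, hE,
      packedSum_map_pack _ (hb n)]

theorem subst_X (g : Matrix (Fin 5) (Fin 5) (ZMod 2)) (j : Fin 5) :
    subst 5 g (X j) = ∑ i, g i j • (X i : Poly 5) := by
  simp [subst]

/-- In characteristic two the difference is the sum of all terms of g p and of p, so a certificate
only has to cancel the concatenation of the two lists. -/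
theorem subst_sub_mem (g : Matrix (Fin 5) (Fin 5) (ZMod 2)) (E : Expo → List Expo)
    (hE : ∀ m : Expo, subst 5 g (m.mono (ZMod 2)) = monoSum (ZMod 2) (E m))
    (hb : ∀ n, ∀ m ∈ E (Expo.ofHex n), m.b < 64 ∧ m.c < 64 ∧ m.d < 64 ∧ m.e < 64)
    (c : List ℕ)
    (h : (mergeAll 11 (c.map packedTerms ++ ((pExpos.flatMap fun n =>
      (E (Expo.ofHex n)).map Expo.pack) ++ pPacked).map fun x => [x])).isEmpty = true) :
    subst 5 g p - p ∈ hit 5 := by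
  have := packedSum_mem_hits _ _ h
  rwa [packedSum_append, packedSum_pPacked, ← subst_p_eq g E hE hb, ← hit_eq_hits,
    ← CharTwo.sub_eq_add] at this

theorem subst_swap_X (i j k : Fin 5) :
    subst 5 (Matrix.swap (ZMod 2) i j) (X k) = X (Equiv.swap i j k) := by
  rw [subst_X, Finset.sum_eq_single (Equiv.swap i j k)]
  · simp [Matrix.swap, Equiv.Perm.permMatrix, PEquiv.toMatrix_apply]
  · intro b _ hb
    have : Equiv.swap i j b ≠ k := fun e => hb (by rw [← e, Equiv.swap_apply_self])
    simp [Matrix.swap, Equiv.Perm.permMatrix, PEquiv.toMatrix_apply, this]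
  · simp

/-- The squares which make up the difference of `p` and its image under a transposition. -/
def swapCertificate (s : Fin 4) : List ℕ :=
  match s with
  | 0 => swapCertificate₀
  | 1 => swapCertificate₁
  | 2 => swapCertificate₂
  | 3 => swapCertificate₃

theorem swap_terms_cancel : ∀ s : Fin 4,
    (mergeAll 11 ((swapCertificate s).map packedTerms ++ ((pExpos.flatMap fun n =>
      [swapExpo s (Expo.ofHex n)].map Expo.pack) ++ pPacked).map fun x => [x])).isEmpty =
        true := by
  decide +kernel

theorem subst_swap_sub_mem (s : Fin 4) :
    subst 5 (Matrix.swap (ZMod 2) s.castSucc s.succ) p - p ∈ hit 5 := by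
  have hb : ∀ n, ∀ m ∈ [swapExpo s (Expo.ofHex n)],
      m.b < 64 ∧ m.c < 64 ∧ m.d < 64 ∧ m.e < 64 := by
    intro n m hm
    rw [List.mem_singleton] at hm
    subst hm
    fin_cases s <;> simp only [swapExpo, Expo.ofHex] <;> omega
  have hE : ∀ m : Expo, SteenrodHit.subst 5 (Matrix.swap (ZMod 2) s.castSucc s.succ)
      (m.mono (ZMod 2)) = monoSum (ZMod 2) [swapExpo s m] := by
    intro m
    simp only [Expo.mono, map_mul, map_pow, subst_swap_X, monoSum, List.map_cons, List.map_nil,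
      List.sum_cons, List.sum_nil, add_zero]
    fin_cases s
    · exact (by ring : (X 1 ^ m.a * X 0 ^ m.b * X 2 ^ m.c * X 3 ^ m.d * X 4 ^ m.e : Poly 5) =
        X 0 ^ m.b * X 1 ^ m.a * X 2 ^ m.c * X 3 ^ m.d * X 4 ^ m.e)
    · exact (by ring : (X 0 ^ m.a * X 2 ^ m.b * X 1 ^ m.c * X 3 ^ m.d * X 4 ^ m.e : Poly 5) =
        X 0 ^ m.a * X 1 ^ m.c * X 2 ^ m.b * X 3 ^ m.d * X 4 ^ m.e)
    · exact (by ring : (X 0 ^ m.a * X 1 ^ m.b * X 3 ^ m.c * X 2 ^ m.d * X 4 ^ m.e : Poly 5) =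
        X 0 ^ m.a * X 1 ^ m.b * X 2 ^ m.d * X 3 ^ m.c * X 4 ^ m.e)
    · exact (by ring : (X 0 ^ m.a * X 1 ^ m.b * X 2 ^ m.c * X 4 ^ m.d * X 3 ^ m.e : Poly 5) =
        X 0 ^ m.a * X 1 ^ m.b * X 2 ^ m.c * X 3 ^ m.e * X 4 ^ m.d)
  exact subst_sub_mem _ (fun m => [swapExpo s m]) hE hb _ (swap_terms_cancel s)

/-- This is the expansion of (x + z t)^n at t = 1. -/
theorem add_pow_eq_sum_odds {R : Type*} [CommRing R] [CharP R 2] (x z : R) (n : ℕ) :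
    (x + z) ^ n = ((odds n).map fun k => x ^ (n - k) * z ^ k).sum := by
  have h := congrArg (Polynomial.evalRingHom 1) (add_C_mul_X_pow x z n)
  rw [map_list_sum, List.map_map] at h
  simpa [Function.comp_def] using h

theorem transvection_terms_cancel :
    (mergeAll 11 (transvectionCertificate.map packedTerms ++ ((pExpos.flatMap fun n =>
      (transvectExpo (Expo.ofHex n)).map Expo.pack) ++ pPacked).map fun x => [x])).isEmpty =
        true := by
  decide +kernel

theorem subst_transvection_X (k : Fin 5) :
    subst 5 (Matrix.transvection 1 2 1) (X k) = if k = 2 then X 2 + X 1 else X k := by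
  rw [subst_X]
  fin_cases k <;>
    simp [Matrix.transvection, Matrix.single_apply, Fin.sum_univ_five, Matrix.one_apply, add_comm]

theorem subst_transvection_sub_mem :
    subst 5 (Matrix.transvection 1 2 1) p - p ∈ hit 5 := by
  refine subst_sub_mem _ transvectExpo (fun m => ?_) (fun n m hm => ?_)
    transvectionCertificate transvection_terms_cancel
  · have h2 : SteenrodHit.subst 5 (Matrix.transvection 1 2 1) (m.mono (ZMod 2)) =
        X 0 ^ m.a * X 1 ^ m.b * (X 2 + X 1) ^ m.c * X 3 ^ m.d * X 4 ^ m.e := by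
      simp only [Expo.mono, map_mul, map_pow, subst_transvection_X]
      rfl
    rw [h2, add_pow_eq_sum_odds, ← List.sum_map_mul_left, mul_assoc, ← List.sum_map_mul_right,
      monoSum, transvectExpo, List.map_map]
    congr 1
    refine List.map_congr_left fun k _ => ?_
    simp only [Function.comp_apply, Expo.mono]
    ring
  · obtain ⟨k, hk, rfl⟩ := List.mem_map.1 hm
    have : k ≤ (Expo.ofHex n).c := by
      rw [odds_eq, oddChoose, List.mem_filter, List.mem_range] at hk
      omega
    simp only [Expo.ofHex] at this ⊢
    omega

end SteenrodHit

end

noncomputable section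

namespace SteenrodHit

open MvPolynomial

/-! ### Invariance of the class of `p` under all of GL₅ -/

theorem subst_sub_mem_mul (g h : Matrix (Fin 5) (Fin 5) (ZMod 2)) (f : Poly 5)
    (hg : subst 5 g f - f ∈ hit 5) (hh : subst 5 h f - f ∈ hit 5) :
    subst 5 (g * h) f - f ∈ hit 5 := by
  have h1 : subst 5 g (subst 5 h f - f) ∈ hit 5 := hit_le_comap 5 g hh
  rw [map_sub] at h1
  rw [subst_mul, AlgHom.comp_apply]
  convert add_mem h1 hg using 1
  abel

/-- Conjugation by a permutation matrix permutes the two indices of a transvection. One transvection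
and the adjacent transpositions therefore yield all transvections. -/
theorem swap_mul_transvection_mul_swap (s : Fin 4) (i j : Fin 5) (hij : i ≠ j) :
    Matrix.swap (ZMod 2) s.castSucc s.succ * Matrix.transvection i j 1 *
      Matrix.swap (ZMod 2) s.castSucc s.succ =
    Matrix.transvection (Equiv.swap s.castSucc s.succ i) (Equiv.swap s.castSucc s.succ j) 1 := by
  revert i j s
  decide +kernel

/-- Every off-diagonal position is reached from `(1, 2)` by exchanges of adjacent indices. -/
theorem offDiag_induction (Q : Fin 5 → Fin 5 → Prop) (h : Q 1 2)
    (hs : ∀ (s : Fin 4) (i j : Fin 5), i ≠ j → Q i j →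
      Q (Equiv.swap s.castSucc s.succ i) (Equiv.swap s.castSucc s.succ j)) :
    ∀ i j, i ≠ j → Q i j := by
  have h02 : Q 0 2 := hs 0 1 2 (by decide) h
  have h03 : Q 0 3 := hs 2 0 2 (by decide) h02
  have h04 : Q 0 4 := hs 3 0 3 (by decide) h03
  have h13 : Q 1 3 := hs 2 1 2 (by decide) h
  have h14 : Q 1 4 := hs 3 1 3 (by decide) h13
  have h23 : Q 2 3 := hs 1 1 3 (by decide) h13
  have h24 : Q 2 4 := hs 3 2 3 (by decide) h23
  have h34 : Q 3 4 := hs 2 2 4 (by decide) h24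
  have h01 : Q 0 1 := hs 1 0 2 (by decide) h02
  have h10 : Q 1 0 := hs 0 0 1 (by decide) h01
  have h20 : Q 2 0 := hs 1 1 0 (by decide) h10
  have h30 : Q 3 0 := hs 2 2 0 (by decide) h20
  have h40 : Q 4 0 := hs 3 3 0 (by decide) h30
  have h21 : Q 2 1 := hs 0 2 0 (by decide) h20
  have h31 : Q 3 1 := hs 0 3 0 (by decide) h30
  have h41 : Q 4 1 := hs 0 4 0 (by decide) h40
  have h32 : Q 3 2 := hs 1 3 1 (by decide) h31
  have h42 : Q 4 2 := hs 1 4 1 (by decide) h41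
  have h43 : Q 4 3 := hs 2 4 2 (by decide) h42
  intro i j hij
  fin_cases i <;> fin_cases j <;> first | exact absurd rfl hij | assumption

/-- By Gaussian elimination an invertible matrix is a product of diagonal matrices and
transvections. Over 𝔽₂ an invertible diagonal matrix is the identity, and a nontrivial transvection
has coefficient 1. -/
theorem subst_p_sub_mem (g : Matrix (Fin 5) (Fin 5) (ZMod 2)) (hg : g.det ≠ 0) :
    subst 5 g p - p ∈ hit 5 := by
  refine Matrix.diagonal_transvection_induction_of_det_ne_zero
    (fun g => subst 5 g p - p ∈ hit 5) g hg (fun D hD => ?_) (fun t => ?_)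
    (fun A B _ _ hA hB => subst_sub_mem_mul A B p hA hB)
  · have h1 : ∀ c : ZMod 2, c ≠ 0 → c = 1 := by decide
    have hD' : D = fun _ => 1 := by
      rw [Matrix.det_diagonal, Finset.prod_ne_zero_iff] at hD
      exact funext fun i => h1 _ (hD i (Finset.mem_univ i))
    rw [hD', Matrix.diagonal_one, subst_one]
    simp
  · have hc : ∀ c : ZMod 2, c = 0 ∨ c = 1 := by decide
    rw [Matrix.TransvectionStruct.toMatrix]
    rcases hc t.c with h | h
    · rw [h, Matrix.transvection_zero, subst_one]
      simp
    · rw [h]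
      refine offDiag_induction (fun i j => subst 5 (Matrix.transvection i j 1) p - p ∈ hit 5)
        subst_transvection_sub_mem (fun s i j hij hQ => ?_) _ _ t.hij
      rw [← swap_mul_transvection_mul_swap s i j hij]
      exact subst_sub_mem_mul _ _ _ (subst_sub_mem_mul _ _ _ (subst_swap_sub_mem s) hQ)
        (subst_swap_sub_mem s)

theorem Expo.isHomogeneous_mono (K : Type*) [CommSemiring K] (m : Expo) :
    (m.mono K).IsHomogeneous m.deg :=
  ((((isHomogeneous_X_pow _ _).mul (isHomogeneous_X_pow _ _)).mul
    (isHomogeneous_X_pow _ _)).mul (isHomogeneous_X_pow _ _)).mul (isHomogeneous_X_pow _ _)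

theorem isHomogeneous_p : p.IsHomogeneous 20 := by
  have hdeg : ∀ n ∈ pExpos, (Expo.ofHex n).deg = 20 := by decide +kernel
  rw [p_eq_sum, ← mem_homogeneousSubmodule]
  refine list_sum_mem fun q hq => ?_
  obtain ⟨n, hn, rfl⟩ := List.mem_map.1 hq
  exact hdeg n hn ▸ Expo.isHomogeneous_mono (ZMod 2) (Expo.ofHex n)

theorem glAction_cls (g : GL (Fin 5) (ZMod 2)) (f : Poly 5) :
    glAction 5 g (cls 5 f) = cls 5 f ↔ subst 5 g.val f - f ∈ hit 5 := by
  change (hit 5).mapQ (hit 5) (subst 5 g.val).toLinearMap (hit_le_comap 5 g.val)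
    ((hit 5).mkQ f) = (hit 5).mkQ f ↔ _
  rw [Submodule.mkQ_apply, Submodule.mapQ_apply, Submodule.Quotient.eq]
  rfl

theorem cls_p_mem_QPinv : cls 5 p ∈ QPinv 5 20 := by
  refine ⟨Submodule.mem_map_of_mem isHomogeneous_p, fun g => ?_⟩
  exact (glAction_cls g p).2 (subst_p_sub_mem g.val (Matrix.GeneralLinearGroup.det_ne_zero g))

end SteenrodHit

end

noncomputable section

namespace SteenrodHit

open MvPolynomial

/-! ### Functionals which vanish on hit polynomials -/

namespace Expo

/-- Equality of exponent vectors, as a Boolean; the packed vectors are compared first. -/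
def beq (m n : Expo) : Bool :=
  cond (Nat.beq m.pack n.pack) (cond (Nat.beq m.c n.c) (cond (Nat.beq m.d n.d)
    (cond (Nat.beq m.a n.a) (cond (Nat.beq m.b n.b) (Nat.beq m.e n.e) false) false) false) false)
    false

theorem beq_eq_true {m n : Expo} : beq m n = true ↔ m = n := by
  refine ⟨fun h => ?_, fun h => ?_⟩
  · obtain ⟨a, b, c, d, e⟩ := m
    obtain ⟨a', b', c', d', e'⟩ := n
    simp only [beq, Bool.cond_false_right, Bool.and_eq_true, Nat.beq_eq] at h
    simp only [mk.injEq]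
    tauto
  · subst h
    simp only [beq, Nat.beq_refl, cond_true]

end Expo

/-- The number of occurrences of `t` in a list. -/
def multiplicity (S : List Expo) (t : Expo) : ℕ :=
  listRec 0 (fun s _ ih => cond (Expo.beq s t) (Nat.succ ih) ih) S

/-- The number of pairs of equal entries of two lists. -/
def pairCount (S L : List Expo) : ℕ :=
  listRec 0 (fun t _ ih => Nat.add (multiplicity S t) ih) L

section

variable (K : Type*) [Field K]

/-- The sum of the coefficients of a polynomial at the monomials in a list. -/
def coeffSum (S : List Expo) : MvPolynomial (Fin 5) K →ₗ[K] K :=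
  (S.map fun s => lcoeff K s.toFinsupp).sum

variable {K}

theorem coeffSum_nil (f : MvPolynomial (Fin 5) K) : coeffSum K [] f = 0 := rfl

theorem coeffSum_cons (s : Expo) (S : List Expo) (f : MvPolynomial (Fin 5) K) :
    coeffSum K (s :: S) f = coeff s.toFinsupp f + coeffSum K S f := by
  simp [coeffSum]

theorem coeffSum_mono (S : List Expo) (t : Expo) :
    coeffSum K S (t.mono K) = (multiplicity S t : K) := by
  induction S with
  | nil => simp [coeffSum_nil, multiplicity, listRec]
  | cons s S ih =>
    have e : multiplicity (s :: S) t =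
      cond (Expo.beq s t) (Nat.succ (multiplicity S t)) (multiplicity S t) := rfl
    rw [coeffSum_cons, ih, e, Expo.mono_eq_monomial, coeff_monomial]
    by_cases h : s = t
    · rw [Expo.beq_eq_true.2 h, if_pos (by rw [h]), cond_true, Nat.cast_succ, add_comm]
    · rw [Bool.eq_false_iff.2 (mt Expo.beq_eq_true.1 h), cond_false,
        if_neg fun e => h (Expo.toFinsupp_injective e).symm, zero_add]

theorem coeffSum_monoSum (S L : List Expo) :
    coeffSum K S (monoSum K L) = (pairCount S L : K) := by
  induction L with
  | nil => simp [monoSum, pairCount, listRec]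
  | cons t L ih =>
    have e : pairCount S (t :: L) = multiplicity S t + pairCount S L := rfl
    rw [e, Nat.cast_add, ← ih, ← coeffSum_mono, ← map_add]
    rfl

theorem pairCount_eq_zero (S L : List Expo) (h : ∀ t ∈ L, t ∉ S) : pairCount S L = 0 := by
  induction L with
  | nil => rfl
  | cons t L ih =>
    have e : pairCount S (t :: L) = multiplicity S t + pairCount S L := rfl
    rw [e, ih fun t ht => h t (List.mem_cons_of_mem _ ht), add_zero]
    have ht := h t List.mem_cons_self
    clear ih h e
    induction S with
    | nil => rfl
    | cons s S ih =>
      have e : multiplicity (s :: S) t =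
        cond (Expo.beq s t) (Nat.succ (multiplicity S t)) (multiplicity S t) := rfl
      rw [List.mem_cons, not_or] at ht
      rw [e, Bool.eq_false_iff.2 (mt Expo.beq_eq_true.1 (Ne.symm ht.1)), cond_false, ih ht.2]

end

/-- Whether `f k` holds for all `k ≤ n`. -/
def allUpTo (n : ℕ) (f : ℕ → Bool) : Bool :=
  @Nat.rec (fun _ => Bool) true (fun k ih => cond (f k) ih false) (Nat.succ n)

theorem allUpTo_eq_true {n : ℕ} {f : ℕ → Bool} (h : allUpTo n f = true) (k : ℕ) (hk : k ≤ n) :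
    f k = true := by
  have : ∀ N, @Nat.rec (fun _ => Bool) true (fun k ih => cond (f k) ih false) N = true →
      ∀ k < N, f k = true := by
    intro N
    induction N with
    | zero => intro _ k hk; omega
    | succ N ih =>
      intro h k hk
      change cond (f N) _ false = true at h
      rw [Bool.cond_false_right, Bool.and_eq_true] at h
      rcases Nat.lt_succ_iff_lt_or_eq.1 hk with hk | rfl
      · exact ih h.2 k hk
      · exact h.1
  exact this _ h k (Nat.lt_succ_of_le hk)

def isOddChoose (n k : ℕ) : Bool :=
  listRec false (fun x _ ih => cond (Nat.beq x k) true ih) (odds n)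

theorem isOddChoose_of_mem {n k : ℕ} (h : k ∈ odds n) : isOddChoose n k = true := by
  unfold isOddChoose
  generalize odds n = l at h
  induction l with
  | nil => simp at h
  | cons x l ih =>
    change cond (Nat.beq x k) true _ = true
    rcases List.mem_cons.1 h with rfl | h
    · rw [Nat.beq_refl, cond_true]
    · rw [Bool.cond_true_left, Bool.or_eq_true]
      exact Or.inr (ih h)

theorem forall_mem_oddLoop {α : Type} (P : α → Prop) (n i : ℕ) (f : ℕ → List α → List α)
    (hf : ∀ k r, k ∈ odds n → k ≤ n → k ≤ i → (∀ t ∈ r, P t) → ∀ t ∈ f k r, P t) (r : List α)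
    (hr : ∀ t ∈ r, P t) : ∀ t ∈ oddLoop n i f r, P t := by
  have hle : ∀ k ∈ odds n, k ≤ n := by
    intro k hk
    rw [odds_eq, oddChoose, List.mem_filter, List.mem_range] at hk
    omega
  unfold oddLoop
  generalize odds n = l at hle hf
  induction l with
  | nil => exact hr
  | cons k l ih =>
    have ih' := ih (fun k hk => hle k (List.mem_cons_of_mem _ hk))
      (fun k r hk => hf k r (List.mem_cons_of_mem _ hk))
    simp only [listRec] at ih' ⊢
    by_cases h : k ≤ i
    · rw [show Nat.ble k i = true from Nat.ble_eq_true_of_le h, cond_true]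
      exact hf _ _ List.mem_cons_self (hle k List.mem_cons_self) h ih'
    · rw [show Nat.ble k i = false from Bool.eq_false_iff.2 fun e => h (Nat.le_of_ble_eq_true e),
        cond_false]
      exact ih'

theorem forall_mem_squareList {α : Type} (P : α → Prop) (m : Expo) (i : ℕ)
    (emit : ℕ → ℕ → ℕ → ℕ → ℕ → α)
    (h : ∀ k₀ ∈ odds m.a, ∀ k₁ ∈ odds m.b, ∀ k₂ ∈ odds m.c, ∀ k₃ ∈ odds m.d, ∀ k₄ ∈ odds m.e,
      k₀ ≤ m.a → k₁ ≤ m.b → k₂ ≤ m.c → k₃ ≤ m.d → k₄ ≤ m.e → k₀ + k₁ + k₂ + k₃ + k₄ = i →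
      P (emit k₀ k₁ k₂ k₃ k₄)) :
    ∀ t ∈ squareList m i emit [], P t := by
  unfold squareList
  refine forall_mem_oddLoop P _ _ _ (fun k₀ r o₀ h₀ i₀ hr => ?_) [] (by simp)
  refine forall_mem_oddLoop P _ _ _ (fun k₁ r o₁ h₁ i₁ hr => ?_) r hr
  refine forall_mem_oddLoop P _ _ _ (fun k₂ r o₂ h₂ i₂ hr => ?_) r hr
  refine forall_mem_oddLoop P _ _ _ (fun k₃ r o₃ h₃ i₃ hr => ?_) r hr
  refine forall_mem_oddLoop P _ _ _ (fun k₄ r o₄ h₄ i₄ hr => ?_) r hr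
  simp only [Nat.sub_eq] at *
  intro t ht
  cases hb : Nat.beq k₄ (i - k₀ - k₁ - k₂ - k₃) with
  | false =>
    rw [hb, cond_false] at ht
    exact hr t ht
  | true =>
    rw [hb, cond_true, List.mem_cons] at ht
    rcases ht with rfl | ht
    · have := Nat.eq_of_beq_eq_true hb
      exact h _ o₀ _ o₁ _ o₂ _ o₃ _ o₄ h₀ h₁ h₂ h₃ h₄ (by omega)
    · exact hr t ht

/-- Whether the coefficient sum over `S` vanishes on the square of `m` of degree `i`, where only
the `i > 0` with `I i` matter. -/
def vanishesAt (tw : Bool) (I : ℕ → Bool) (S : List Expo) (m : Expo) (i : ℕ) : Bool :=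
  cond (Nat.beq i 0) true (cond (I i)
    (Nat.beq (pairCount S (squareList m i (m.shift tw) []) % 2) 0) true)

/-- The monomial of which `s` is a term of a square, in which `kⱼ` of the factors `x_j` are
squared. -/
def Expo.unshift (tw : Bool) (s : Expo) (k₀ k₁ k₂ k₃ k₄ : ℕ) : Expo :=
  cond tw ⟨s.a + k₀ - 2 * k₁, s.b + k₁ - 2 * k₂, s.c + k₂ - 2 * k₃, s.d + k₃ - 2 * k₄,
      s.e + k₄ - 2 * k₀⟩
    ⟨s.a - k₀, s.b - k₁, s.c - k₂, s.d - k₃, s.e - k₄⟩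

theorem Expo.unshift_shift (tw : Bool) (m : Expo) (k₀ k₁ k₂ k₃ k₄ : ℕ)
    (h₀ : k₀ ≤ m.a) (h₁ : k₁ ≤ m.b) (h₂ : k₂ ≤ m.c) (h₃ : k₃ ≤ m.d) (h₄ : k₄ ≤ m.e) :
    (m.shift tw k₀ k₁ k₂ k₃ k₄).unshift tw k₀ k₁ k₂ k₃ k₄ = m := by
  obtain ⟨a, b, c, d, e⟩ := m
  cases tw <;> simp only [Expo.unshift, Expo.shift, cond_true, cond_false, Expo.mk.injEq] at * <;>
    omega

/-- Whether the coefficient sum over `S` vanishes on all squares of monomials among whose terms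
is `s`. -/
def vanishesBelow (tw : Bool) (I : ℕ → Bool) (S : List Expo) (s : Expo) : Bool :=
  -- If `k₀` of the `m.a` factors are squared, they contribute `2 * k₀` to the exponent of the
  -- variable they turn into: x₁ itself, or the last variable in the twisted case. Hence half that
  -- exponent bounds `k₀`, and likewise for the others. Each exponent of the source monomial is
  -- tested as soon as the chosen numbers determine it, which prunes the search.
  allUpTo (cond tw s.e s.a / 2) fun k₀ => allUpTo (cond tw s.a s.b / 2) fun k₁ =>
    cond (isOddChoose (s.unshift tw k₀ k₁ 0 0 0).a k₀)
      (allUpTo (cond tw s.b s.c / 2) fun k₂ =>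
        cond (isOddChoose (s.unshift tw k₀ k₁ k₂ 0 0).b k₁)
          (allUpTo (cond tw s.c s.d / 2) fun k₃ =>
            cond (isOddChoose (s.unshift tw k₀ k₁ k₂ k₃ 0).c k₂)
              (allUpTo (cond tw s.d s.e / 2) fun k₄ =>
                cond (isOddChoose (s.unshift tw k₀ k₁ k₂ k₃ k₄).d k₃)
                  (cond (isOddChoose (s.unshift tw k₀ k₁ k₂ k₃ k₄).e k₄)
                    (vanishesAt tw I S (s.unshift tw k₀ k₁ k₂ k₃ k₄) (k₀ + k₁ + k₂ + k₃ + k₄))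
                    true) true) true) true) true

theorem vanishesAt_of_vanishesBelow {tw : Bool} {I : ℕ → Bool} {S : List Expo} {m : Expo}
    {k₀ k₁ k₂ k₃ k₄ : ℕ} (o₀ : k₀ ∈ odds m.a) (o₁ : k₁ ∈ odds m.b) (o₂ : k₂ ∈ odds m.c)
    (o₃ : k₃ ∈ odds m.d) (o₄ : k₄ ∈ odds m.e)
    (h₀ : k₀ ≤ m.a) (h₁ : k₁ ≤ m.b) (h₂ : k₂ ≤ m.c) (h₃ : k₃ ≤ m.d) (h₄ : k₄ ≤ m.e)
    (h : vanishesBelow tw I S (m.shift tw k₀ k₁ k₂ k₃ k₄) = true) :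
    vanishesAt tw I S m (k₀ + k₁ + k₂ + k₃ + k₄) = true := by
  have hm := Expo.unshift_shift tw m k₀ k₁ k₂ k₃ k₄ h₀ h₁ h₂ h₃ h₄
  have ea : ∀ s : Expo, (s.unshift tw k₀ k₁ 0 0 0).a = (s.unshift tw k₀ k₁ k₂ k₃ k₄).a := by
    intro s; cases tw <;> rfl
  have eb : ∀ s : Expo, (s.unshift tw k₀ k₁ k₂ 0 0).b = (s.unshift tw k₀ k₁ k₂ k₃ k₄).b := by
    intro s; cases tw <;> rfl
  have ec : ∀ s : Expo, (s.unshift tw k₀ k₁ k₂ k₃ 0).c = (s.unshift tw k₀ k₁ k₂ k₃ k₄).c := by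
    intro s; cases tw <;> rfl
  have h' := allUpTo_eq_true (allUpTo_eq_true h k₀ ?_) k₁ ?_
  · rw [ea, hm, isOddChoose_of_mem o₀, cond_true] at h'
    replace h' := allUpTo_eq_true h' k₂ ?_
    · rw [eb, hm, isOddChoose_of_mem o₁, cond_true] at h'
      replace h' := allUpTo_eq_true h' k₃ ?_
      · rw [ec, hm, isOddChoose_of_mem o₂, cond_true] at h'
        replace h' := allUpTo_eq_true h' k₄ ?_
        · rwa [hm, isOddChoose_of_mem o₃, cond_true, isOddChoose_of_mem o₄, cond_true] at h'
        · cases tw <;> simp only [Expo.shift, cond_true, cond_false] <;> omega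
      · cases tw <;> simp only [Expo.shift, cond_true, cond_false] <;> omega
    · cases tw <;> simp only [Expo.shift, cond_true, cond_false] <;> omega
  all_goals cases tw <;> simp only [Expo.shift, cond_true, cond_false] <;> omega

/-- Whether the coefficient sum over `S` vanishes on hit polynomials. -/
def vanishes (tw : Bool) (I : ℕ → Bool) (S : List Expo) : Bool :=
  listRec true (fun s _ ih => cond (vanishesBelow tw I S s) ih false) S

theorem vanishesBelow_of_mem {tw : Bool} {I : ℕ → Bool} {S T : List Expo}
    (h : listRec true (fun s _ ih => cond (vanishesBelow tw I S s) ih false) T = true) {s : Expo}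
    (hs : s ∈ T) : vanishesBelow tw I S s = true := by
  induction T with
  | nil => simp at hs
  | cons t T ih =>
    simp only [listRec, Bool.cond_false_right, Bool.and_eq_true] at h ih
    rcases List.mem_cons.1 hs with rfl | hs
    · exact h.1
    · exact ih h.2 hs

/-- If no term of the square lies in `S`, the count is zero. Otherwise the square is among those
checked below such a term. This reduces a condition on infinitely many monomials to a finite one. -/
theorem even_pairCount {tw : Bool} {I : ℕ → Bool} {S : List Expo} (h : vanishes tw I S = true)
    (m : Expo) {i : ℕ}
    (hi : 0 < i) (hI : I i = true) : pairCount S (squareList m i (m.shift tw) []) % 2 = 0 := by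
  by_contra hne
  refine hne ?_
  rw [pairCount_eq_zero]
  refine forall_mem_squareList _ m i _ ?_
  intro k₀ o₀ k₁ o₁ k₂ o₂ k₃ o₃ k₄ o₄ h₀ h₁ h₂ h₃ h₄ hsum hmem
  apply hne
  have hb := vanishesAt_of_vanishesBelow o₀ o₁ o₂ o₃ o₄ h₀ h₁ h₂ h₃ h₄
    (vanishesBelow_of_mem h hmem)
  rw [hsum, vanishesAt, Bool.eq_false_iff.2 fun e => hi.ne' (Nat.eq_of_beq_eq_true e),
    cond_false, hI, cond_true] at hb
  exact Nat.eq_of_beq_eq_true hb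

theorem coeffSum_coeff_totalSqOver {K : Type*} [Field K] [CharP K 2] {tw : Bool} {I : ℕ → Bool}
    {S : List Expo} (h : vanishes tw I S = true) {i : ℕ} (hi : 0 < i) (hI : I i = true)
    (f : MvPolynomial (Fin 5) K) : coeffSum K S ((totalSqOver K tw f).coeff i) = 0 := by
  refine mem_of_mono_mem (LinearMap.ker (coeffSum K S ∘ₗ
    (Polynomial.lcoeff (MvPolynomial (Fin 5) K) i).restrictScalars K ∘ₗ
      (totalSqOver K tw).toLinearMap)) f fun m _ => ?_
  rw [LinearMap.mem_ker]
  change coeffSum K S ((totalSqOver K tw (m.mono K)).coeff i) = 0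
  have hs := sum_squareList (K := K) tw m i (m.shift tw) (Expo.mono K)
    (fun k₀ k₁ k₂ k₃ k₄ h₀ h₁ h₂ h₃ h₄ => Expo.mono_shift K tw m _ _ _ _ _ h₀ h₁ h₂ h₃ h₄) []
  rw [List.map_nil, List.sum_nil, add_zero] at hs
  rw [← hs]
  exact (coeffSum_monoSum S _).trans ((CharP.cast_eq_zero_iff K 2 _).2
    (Nat.dvd_of_mod_eq_zero (even_pairCount h m hi hI)))

theorem coeffSum_eq_zero_of_mem_hits {K : Type*} [Field K] [CharP K 2] {tw : Bool}
    {S : List Expo} (h : vanishes tw (fun _ => true) S = true) {f : MvPolynomial (Fin 5) K}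
    (hf : f ∈ hits K tw) : coeffSum K S f = 0 := by
  refine (Submodule.span_le (p := LinearMap.ker (coeffSum K S))).2 ?_ hf
  rintro _ ⟨i, f, hi, rfl⟩
  exact coeffSum_coeff_totalSqOver h hi rfl f

/-- The inner entries of row 2^n of Pascal's triangle are even, so consecutive entries of the row
above agree modulo 2. -/
theorem choose_two_pow_sub_one (n a : ℕ) (ha : a < 2 ^ n) :
    ((2 ^ n - 1).choose a : ZMod 2) = 1 := by
  induction a with
  | zero => simp
  | succ a ih =>
    have h1 : ((2 ^ n).choose (a + 1) : ZMod 2) = 0 :=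
      (ZMod.natCast_eq_zero_iff _ _).2
        (Nat.prime_two.dvd_choose_pow (Nat.succ_ne_zero a) ha.ne)
    have h2 : 2 ^ n = (2 ^ n - 1) + 1 := by omega
    rw [h2, Nat.choose_succ_succ, Nat.cast_add, ih (by omega)] at h1
    exact (CharTwo.add_eq_zero.1 h1).symm

/-- A functional which vanishes on the squares whose degrees are powers of two vanishes on all
squares of positive degree. -/
theorem vanishes_of_two_pow {k : ℕ} (φ : Poly k →ₗ[ZMod 2] ZMod 2)
    (h : ∀ n f, φ (Sq k (2 ^ n) f) = 0) (i : ℕ) (hi : 0 < i) (f : Poly k) :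
    φ (Sq k i f) = 0 := by
  induction i using Nat.strong_induction_on generalizing f with
  | _ i ih =>
    obtain ⟨n, hn, hn'⟩ : ∃ n, 2 ^ n ≤ i ∧ i < 2 ^ (n + 1) :=
      ⟨Nat.log 2 i, Nat.pow_log_le_self 2 hi.ne', Nat.lt_pow_succ_log_self one_lt_two i⟩
    obtain ⟨a, rfl⟩ : ∃ a, i = a + 2 ^ n := ⟨i - 2 ^ n, by omega⟩
    rcases Nat.eq_zero_or_pos a with rfl | ha
    · rw [zero_add]
      exact h n f
    have hlt : a < 2 ^ n := by rw [pow_succ] at hn'; omega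
    -- With a < 2^n, the Adem relation for Sq^a Sq^(2^n) has the term j = 0 equal to Sq^(a+2^n),
    -- because C(2^n - 1, a) is odd. The left side and all terms with j > 0 begin with a square of
    -- positive degree less than a + 2^n, so the induction hypothesis kills them.
    have hA := congrArg φ (LinearMap.congr_fun (adem_sq k a (2 ^ n) (by omega)) f)
    rw [Finset.sum_range_succ', LinearMap.add_apply, map_add, LinearMap.sum_apply, map_sum,
      Finset.sum_eq_zero, Module.End.mul_apply, ih a (by omega) ha, zero_add] at hA
    · simpa [sq_zero, choose_two_pow_sub_one n a hlt] using hA.symm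
    · intro j hj
      have hj' := Finset.mem_range.1 hj
      rw [LinearMap.smul_apply, map_smul, Module.End.mul_apply,
        ih _ (by omega) (by omega), smul_zero]

/-! ### The polynomial `p` is not hit -/

/-- The monomials of a functional which vanishes on hit polynomials but not on `p`. -/
def pDetector : List Expo :=
  [⟨1, 1, 14, 1, 3⟩, ⟨2, 1, 13, 1, 3⟩, ⟨3, 1, 3, 10, 3⟩, ⟨3, 1, 5, 8, 3⟩, ⟨3, 1, 6, 7, 3⟩,
   ⟨3, 1, 9, 4, 3⟩, ⟨3, 1, 11, 2, 3⟩, ⟨3, 2, 3, 9, 3⟩, ⟨3, 2, 9, 3, 3⟩, ⟨3, 3, 5, 6, 3⟩,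
   ⟨3, 4, 5, 5, 3⟩, ⟨3, 5, 6, 3, 3⟩, ⟨3, 6, 5, 3, 3⟩, ⟨3, 7, 3, 4, 3⟩, ⟨3, 8, 3, 3, 3⟩,
   ⟨4, 1, 11, 1, 3⟩, ⟨5, 1, 3, 8, 3⟩, ⟨5, 1, 5, 6, 3⟩, ⟨5, 1, 7, 4, 3⟩, ⟨5, 1, 9, 2, 3⟩,
   ⟨5, 2, 3, 7, 3⟩, ⟨5, 2, 5, 5, 3⟩, ⟨5, 2, 7, 3, 3⟩, ⟨5, 3, 3, 6, 3⟩, ⟨5, 3, 6, 3, 3⟩,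
   ⟨5, 4, 3, 5, 3⟩, ⟨5, 4, 5, 3, 3⟩, ⟨5, 7, 3, 2, 3⟩, ⟨6, 1, 9, 1, 3⟩, ⟨6, 7, 3, 1, 3⟩,
   ⟨7, 1, 5, 4, 3⟩, ⟨7, 1, 7, 2, 3⟩, ⟨7, 2, 5, 3, 3⟩, ⟨8, 1, 7, 1, 3⟩, ⟨9, 1, 3, 4, 3⟩,
   ⟨9, 1, 5, 2, 3⟩, ⟨9, 2, 3, 3, 3⟩, ⟨10, 1, 5, 1, 3⟩, ⟨11, 1, 3, 2, 3⟩, ⟨12, 1, 3, 1, 3⟩]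

/-- The test also accepts 0, which is harmless because only positive degrees are examined. -/
def isTwoPow (i : ℕ) : Bool := Nat.beq (Nat.land i (Nat.pred i)) 0

theorem isTwoPow_two_pow (n : ℕ) : isTwoPow (2 ^ n) = true := by
  have h : Nat.land (2 ^ n) (Nat.pred (2 ^ n)) = 0 := by
    change 2 ^ n &&& (2 ^ n - 1) = 0
    rw [Nat.and_two_pow_sub_one_eq_mod, Nat.mod_self]
  rw [isTwoPow, h]
  rfl

theorem vanishes_pDetector : vanishes false isTwoPow pDetector = true := by decide +kernel

theorem coeffSum_pDetector_eq_zero {f : Poly 5} (hf : f ∈ hit 5) :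
    coeffSum (ZMod 2) pDetector f = 0 := by
  have hv := vanishes_pDetector
  rw [hit_eq_hits] at hf
  generalize pDetector = S at hv
  refine (Submodule.span_le (p := LinearMap.ker (coeffSum (ZMod 2) S))).2 ?_ hf
  rintro _ ⟨i, f, hi, rfl⟩
  exact vanishes_of_two_pow (k := 5) (coeffSum (ZMod 2) S)
    (fun n f => coeffSum_coeff_totalSqOver hv (Nat.two_pow_pos n)
      (isTwoPow_two_pow n) f) i hi f

theorem coeffSum_pDetector_p : coeffSum (ZMod 2) pDetector p = 1 := by
  have h : pairCount pDetector (pExpos.map Expo.ofHex) % 2 = 1 := by decide +kernel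
  have e : p = monoSum (ZMod 2) (pExpos.map Expo.ofHex) := by
    rw [p_eq_sum, monoSum, List.map_map]
    rfl
  rw [e, coeffSum_monoSum, ← ZMod.natCast_mod, h, Nat.cast_one]

end SteenrodHit

end

noncomputable section

namespace SteenrodHit

open MvPolynomial

/-! ### Extension of scalars -/

section BaseChange

variable (K : Type*) [Field K] [Algebra (ZMod 2) K]

/-- Extension of scalars of polynomials. -/
def extend : MvPolynomial (Fin 5) (ZMod 2) →+* MvPolynomial (Fin 5) K :=
  MvPolynomial.map (algebraMap (ZMod 2) K)

theorem totalSqOver_extend (tw : Bool) (f : MvPolynomial (Fin 5) (ZMod 2)) :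
    totalSqOver K tw (extend K f) = (totalSqOver (ZMod 2) tw f).map (extend K) := by
  have : ((totalSqOver K tw : _ →+* _).comp (extend K)) =
      (Polynomial.mapRingHom (extend K)).comp (totalSqOver (ZMod 2) tw : _ →+* _) := by
    refine MvPolynomial.ringHom_ext' (Subsingleton.elim _ _) fun j => ?_
    simp [extend, totalSqOver_X]
  exact DFunLike.congr_fun this f

theorem extend_mem_hits {tw : Bool} {f : MvPolynomial (Fin 5) (ZMod 2)}
    (hf : f ∈ hits (ZMod 2) tw) : extend K f ∈ hits K tw := by
  induction hf using Submodule.span_induction with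
  | mem x hx =>
    obtain ⟨i, f, hi, rfl⟩ := hx
    have h := coeff_totalSqOver_mem_hits (tw := tw) hi (extend K f)
    rwa [totalSqOver_extend, Polynomial.coeff_map] at h
  | zero => simp
  | add x y _ _ hx hy => rw [map_add]; exact add_mem hx hy
  | smul c x _ hx =>
    rw [smul_eq_C_mul, map_mul, extend, map_C, ← smul_eq_C_mul]
    exact Submodule.smul_mem _ _ hx

/-- The extension of a functional to polynomials over `K`. -/
def extendFunctional (φ : MvPolynomial (Fin 5) (ZMod 2) →ₗ[ZMod 2] ZMod 2) :
    MvPolynomial (Fin 5) K →ₗ[K] K :=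
  (basisMonomials (Fin 5) K).constr K fun s => algebraMap (ZMod 2) K (φ (monomial s 1))

theorem extendFunctional_mono (φ : MvPolynomial (Fin 5) (ZMod 2) →ₗ[ZMod 2] ZMod 2) (m : Expo) :
    extendFunctional K φ (m.mono K) = algebraMap (ZMod 2) K (φ (m.mono (ZMod 2))) := by
  have h := (basisMonomials (Fin 5) K).constr_basis K
    (fun s => algebraMap (ZMod 2) K (φ (monomial s 1))) m.toFinsupp
  rw [coe_basisMonomials] at h
  rw [Expo.mono_eq_monomial, Expo.mono_eq_monomial]
  exact h

theorem extend_mono (m : Expo) : extend K (m.mono (ZMod 2)) = m.mono K := by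
  simp [extend, Expo.mono]

theorem extendFunctional_extend (φ : MvPolynomial (Fin 5) (ZMod 2) →ₗ[ZMod 2] ZMod 2)
    (f : MvPolynomial (Fin 5) (ZMod 2)) :
    extendFunctional K φ (extend K f) = algebraMap (ZMod 2) K (φ f) := by
  rw [f.as_sum, map_sum, map_sum, map_sum, map_sum]
  refine Finset.sum_congr rfl fun s _ => ?_
  have e : monomial s (coeff s f) = coeff s f • (Expo.ofFinsupp s).mono (ZMod 2) := by
    rw [← Expo.monomial_eq_mono, smul_monomial, smul_eq_mul, mul_one]
  have e' : extend K (coeff s f • (Expo.ofFinsupp s).mono (ZMod 2)) =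
      algebraMap (ZMod 2) K (coeff s f) • (Expo.ofFinsupp s).mono K := by
    rw [smul_eq_C_mul, map_mul, extend_mono, extend, map_C, ← smul_eq_C_mul]
  rw [e, e', map_smul, extendFunctional_mono, map_smul, smul_eq_mul, smul_eq_mul, map_mul]

/-- Squares of monomials have coefficients in 𝔽₂, so the hit polynomials over K are spanned by
extensions of hit polynomials over 𝔽₂. -/
theorem extendFunctional_eq_zero {tw : Bool}
    (φ : MvPolynomial (Fin 5) (ZMod 2) →ₗ[ZMod 2] ZMod 2)
    (hφ : ∀ f ∈ hits (ZMod 2) tw, φ f = 0) {f : MvPolynomial (Fin 5) K} (hf : f ∈ hits K tw) :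
    extendFunctional K φ f = 0 := by
  refine (Submodule.span_le (p := LinearMap.ker (extendFunctional K φ))).2 ?_ hf
  rintro _ ⟨i, f, hi, rfl⟩
  refine mem_of_mono_mem (LinearMap.ker (extendFunctional K φ ∘ₗ
    (Polynomial.lcoeff (MvPolynomial (Fin 5) K) i).restrictScalars K ∘ₗ
      (totalSqOver K tw).toLinearMap)) f fun m _ => ?_
  rw [LinearMap.mem_ker]
  change extendFunctional K φ ((totalSqOver K tw (m.mono K)).coeff i) = 0
  rw [← extend_mono, totalSqOver_extend, Polynomial.coeff_map,
    extendFunctional_extend, hφ _ (coeff_totalSqOver_mem_hits hi _), map_zero]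

end BaseChange

/-! ### The field with 32 elements and the twisted coordinates -/

section Twist

variable {K : Type*} [Field K]

/-- The linear form with the coordinates `δ, δ², δ⁴, δ⁸, δ¹⁶`. -/
def conjForm (δ : K) : MvPolynomial (Fin 5) K := ∑ i : Fin 5, δ ^ 2 ^ (i : ℕ) • X i

theorem conjForm_eq (δ : K) : conjForm δ =
    δ • X 0 + δ ^ 2 • X 1 + δ ^ 4 • X 2 + δ ^ 8 • X 3 + δ ^ 16 • X 4 := by
  simp [conjForm, Fin.sum_univ_five]

theorem conjForm_add [CharP K 2] (δ ε : K) : conjForm (δ + ε) = conjForm δ + conjForm ε := by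
  simp only [conjForm, add_pow_char_pow, add_smul, Finset.sum_add_distrib]

theorem conjForm_zero : conjForm (0 : K) = 0 := by
  simp [conjForm_eq]

theorem conjForm_sum [CharP K 2] {ι : Type*} (s : Finset ι) (δ : ι → K) :
    conjForm (∑ i ∈ s, δ i) = ∑ i ∈ s, conjForm (δ i) :=
  map_sum (⟨⟨conjForm, conjForm_zero⟩, conjForm_add⟩ : K →+ MvPolynomial (Fin 5) K) δ s

/-- Squaring shifts the conjugates δ^(2^i) cyclically, since δ³² = δ. The rotation in the twisted
total square compensates this shift, and the form behaves as a linear form over 𝔽₂ does under the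
ordinary total square. -/
theorem totalSqOver_conjForm [CharP K 2] {δ : K} (hδ : δ ^ 32 = δ) :
    totalSqOver K true (conjForm δ) =
      Polynomial.C (conjForm δ) + Polynomial.C (conjForm δ ^ 2) * Polynomial.X := by
  have h : conjForm δ ^ 2 =
      δ • X 4 ^ 2 + δ ^ 2 • X 0 ^ 2 + δ ^ 4 • X 1 ^ 2 + δ ^ 8 • X 2 ^ 2 + δ ^ 16 • X 3 ^ 2 := by
    rw [conjForm_eq]
    simp only [CharTwo.add_sq, smul_pow, ← pow_mul, Nat.reduceMul, hδ]
    abel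
  rw [h, conjForm_eq]
  simp only [map_add, map_smul, totalSqOver_X, squareSource, cond_true,
    show (0 : Fin 5) + 4 = 4 from rfl, show (1 : Fin 5) + 4 = 0 from rfl,
    show (2 : Fin 5) + 4 = 1 from rfl, show (3 : Fin 5) + 4 = 2 from rfl,
    show (4 : Fin 5) + 4 = 3 from rfl, smul_add, add_mul, ← smul_mul_assoc, Polynomial.smul_C]
  abel

/-- The change to the twisted coordinates, given the first coordinates of the variables. -/
def toTwisted (β : Fin 5 → K) : MvPolynomial (Fin 5) K →ₐ[K] MvPolynomial (Fin 5) K :=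
  aeval fun j => conjForm (β j)

theorem toTwisted_mem_hits [CharP K 2] {β : Fin 5 → K} (hβ : ∀ j, β j ^ 32 = β j)
    {f : MvPolynomial (Fin 5) K} (hf : f ∈ hits K false) : toTwisted β f ∈ hits K true := by
  refine map_mem_hits _ (fun j => ?_) hf
  simp [toTwisted, totalSqOver_X, totalSqOver_conjForm (hβ j), squareSource]

/-- The change from the twisted coordinates. -/
def ofTwisted (γ : Fin 5 → K) : MvPolynomial (Fin 5) K →ₐ[K] MvPolynomial (Fin 5) K :=
  aeval fun i => ∑ k, γ k ^ 2 ^ (i : ℕ) • X k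

theorem pow_squareSource {δ : K} (hδ : δ ^ 32 = δ) (i : Fin 5) :
    (δ ^ 2 ^ ((squareSource true i : Fin 5) : ℕ)) ^ 2 = δ ^ 2 ^ (i : ℕ) := by
  have h : δ ^ 32 = δ ^ 1 := by rw [hδ, pow_one]
  rw [← pow_mul]
  fin_cases i
  · exact h
  all_goals rfl

theorem ofTwisted_X (γ : Fin 5 → K) (i : Fin 5) :
    ofTwisted γ (X i) = ∑ k, γ k ^ 2 ^ (i : ℕ) • X k := by
  simp [ofTwisted]

theorem ofTwisted_mem_hits [CharP K 2] {γ : Fin 5 → K} (hγ : ∀ j, γ j ^ 32 = γ j)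
    {f : MvPolynomial (Fin 5) K} (hf : f ∈ hits K true) : ofTwisted γ f ∈ hits K false := by
  refine map_mem_hits _ (fun i => ?_) hf
  have h : (∑ k, γ k ^ 2 ^ ((squareSource true i : Fin 5) : ℕ) •
      (X k : MvPolynomial (Fin 5) K)) ^ 2 =
      ∑ k, γ k ^ 2 ^ (i : ℕ) • (X k : MvPolynomial (Fin 5) K) ^ 2 := by
    rw [CharTwo.sum_sq]
    refine Finset.sum_congr rfl fun k _ => ?_
    rw [smul_pow, pow_squareSource (hγ k)]
  rw [totalSqOver_X, Polynomial.map_add, Polynomial.map_mul, Polynomial.map_C, Polynomial.map_C,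
    Polynomial.map_X, RingHom.coe_coe, map_pow, ofTwisted_X, ofTwisted_X, h, map_sum, map_sum,
    map_sum, Finset.sum_mul, ← Finset.sum_add_distrib]
  refine Finset.sum_congr rfl fun k _ => ?_
  rw [map_smul, totalSqOver_X, squareSource, cond_false, smul_add, Polynomial.smul_C,
    ← smul_mul_assoc, Polynomial.smul_C]

/-- The hypothesis says that β and γ are dual bases for the trace form of 𝔽₃₂ over 𝔽₂. -/
theorem ofTwisted_toTwisted {β γ : Fin 5 → K}
    (h : ∀ j k, ∑ i : Fin 5, β j ^ 2 ^ (i : ℕ) * γ k ^ 2 ^ (i : ℕ) = if j = k then 1 else 0)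
    (f : MvPolynomial (Fin 5) K) : ofTwisted γ (toTwisted β f) = f := by
  have : (ofTwisted γ).comp (toTwisted β) = AlgHom.id K _ := by
    refine MvPolynomial.algHom_ext fun j => ?_
    simp only [AlgHom.comp_apply, toTwisted, aeval_X, conjForm, map_sum, map_smul, ofTwisted,
      Finset.smul_sum, smul_smul, AlgHom.id_apply]
    rw [Finset.sum_comm]
    simp only [← Finset.sum_smul, h, ite_smul, one_smul, zero_smul, Finset.sum_ite_eq,
      Finset.mem_univ, if_true]
  exact DFunLike.congr_fun this f

/-- The diagonal map which multiplies `y_i` by `α ^ 2 ^ i`. -/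
def diagMap (α : K) : MvPolynomial (Fin 5) K →ₐ[K] MvPolynomial (Fin 5) K :=
  aeval fun i => α ^ 2 ^ (i : ℕ) • X i

/-- The rotation `y_i ↦ y_{i-1}`. -/
def rotMap : MvPolynomial (Fin 5) K →ₐ[K] MvPolynomial (Fin 5) K := aeval fun i => X (i + 4)

/-- The map `y_i ↦ y_i + y_{i+2} + y_{i+3}`. -/
def mixMap : MvPolynomial (Fin 5) K →ₐ[K] MvPolynomial (Fin 5) K :=
  aeval fun i => X i + X (i + 2) + X (i + 3)

/-- As a function of δ, `conjForm` is additive and identifies 𝔽₃₂ with the 𝔽₂-linear forms in x₁, …,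
x₅. Under this identification `diagMap`, `rotMap` and `mixMap` correspond to multiplication by α, to
the Frobenius map and to δ ↦ δ + δ⁴ + δ⁸. -/
theorem diagMap_conjForm (α δ : K) : diagMap α (conjForm δ) = conjForm (α * δ) := by
  simp only [diagMap, conjForm, map_sum, map_smul, aeval_X, smul_smul, mul_pow, mul_comm]

theorem rotMap_conjForm {δ : K} (hδ : δ ^ 32 = δ) : rotMap (conjForm δ) = conjForm (δ ^ 2) := by
  rw [conjForm_eq, conjForm_eq]
  simp only [rotMap, map_add, map_smul, aeval_X, ← pow_mul, Nat.reduceMul, hδ,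
    show (0 : Fin 5) + 4 = 4 from rfl, show (1 : Fin 5) + 4 = 0 from rfl,
    show (2 : Fin 5) + 4 = 1 from rfl, show (3 : Fin 5) + 4 = 2 from rfl,
    show (4 : Fin 5) + 4 = 3 from rfl]
  abel

theorem mixMap_conjForm [CharP K 2] {δ : K} (hδ : δ ^ 32 = δ) :
    mixMap (conjForm δ) = conjForm (δ + δ ^ 4 + δ ^ 8) := by
  have h64 : δ ^ 64 = δ ^ 2 := by rw [show 64 = 32 * 2 from rfl, pow_mul, hδ]
  have h128 : δ ^ 128 = δ ^ 4 := by rw [show 128 = 32 * 4 from rfl, pow_mul, hδ]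
  rw [conjForm_add, conjForm_add, conjForm_eq, conjForm_eq, conjForm_eq]
  simp only [mixMap, map_add, map_smul, aeval_X, ← pow_mul, Nat.reduceMul, hδ, h64, h128,
    smul_add, show (0 : Fin 5) + 2 = 2 from rfl, show (1 : Fin 5) + 2 = 3 from rfl,
    show (2 : Fin 5) + 2 = 4 from rfl, show (3 : Fin 5) + 2 = 0 from rfl,
    show (4 : Fin 5) + 2 = 1 from rfl, show (0 : Fin 5) + 3 = 3 from rfl,
    show (1 : Fin 5) + 3 = 4 from rfl, show (2 : Fin 5) + 3 = 0 from rfl,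
    show (3 : Fin 5) + 3 = 1 from rfl, show (4 : Fin 5) + 3 = 2 from rfl]
  abel

theorem rotMap_mem_hits {f : MvPolynomial (Fin 5) K} (hf : f ∈ hits K true) :
    rotMap f ∈ hits K true := by
  refine map_mem_hits _ (fun i => ?_) hf
  simp [rotMap, totalSqOver_X, squareSource]

theorem diagMap_mem_hits {α : K} (hα : α ^ 32 = α) {f : MvPolynomial (Fin 5) K}
    (hf : f ∈ hits K true) : diagMap α f ∈ hits K true := by
  refine map_mem_hits _ (fun i => ?_) hf
  have e : ∀ i : Fin 5, diagMap α (X i) = α ^ 2 ^ (i : ℕ) • X i := fun i => by simp [diagMap]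
  rw [totalSqOver_X, Polynomial.map_add, Polynomial.map_mul, Polynomial.map_C, Polynomial.map_C,
    Polynomial.map_X, RingHom.coe_coe, map_pow, e, e, smul_pow, pow_squareSource hα, map_smul,
    totalSqOver_X, smul_add, Polynomial.smul_C, ← smul_mul_assoc, Polynomial.smul_C]

variable [CharP K 2] [Algebra (ZMod 2) K]

/-- Substitutions in twisted coordinates. -/
theorem toTwisted_subst {β : Fin 5 → K} (g : Matrix (Fin 5) (Fin 5) (ZMod 2))
    (A : MvPolynomial (Fin 5) K →ₐ[K] MvPolynomial (Fin 5) K)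
    (hA : ∀ j, A (conjForm (β j)) = conjForm (∑ k, algebraMap (ZMod 2) K (g k j) * β k))
    (f : Poly 5) : toTwisted β (extend K (subst 5 g f)) = A (toTwisted β (extend K f)) := by
  have : ((toTwisted β : MvPolynomial (Fin 5) K →+* MvPolynomial (Fin 5) K).comp
      (extend K)).comp (subst 5 g : Poly 5 →+* Poly 5) =
      (A : MvPolynomial (Fin 5) K →+* MvPolynomial (Fin 5) K).comp
        ((toTwisted β : MvPolynomial (Fin 5) K →+* MvPolynomial (Fin 5) K).comp (extend K)) := by
    refine MvPolynomial.ringHom_ext' (Subsingleton.elim _ _) fun j => ?_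
    have hc : ∀ c : ZMod 2, c = 0 ∨ c = 1 := by decide
    simp only [RingHom.comp_apply, RingHom.coe_coe, subst_X, map_sum, smul_eq_C_mul, map_mul,
      extend, map_C, map_X]
    simp only [toTwisted, aeval_X, aeval_C, hA, conjForm_sum]
    refine Finset.sum_congr rfl fun k _ => ?_
    rcases hc (g k j) with h | h <;> simp [h, conjForm_zero]
  exact DFunLike.congr_fun this f

end Twist

end SteenrodHit

end

noncomputable section

namespace SteenrodHit

open MvPolynomial

/-! ### Sums over the powers of an endomorphism -/

/-- The sum of the first `n` powers of an endomorphism. -/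
def powSum {K V : Type*} [Field K] [AddCommGroup V] [Module K V] (A : Module.End K V) (n : ℕ) :
    Module.End K V :=
  ∑ i ∈ Finset.range n, A ^ i

section PowSum

variable {K V : Type*} [Field K] [AddCommGroup V] [Module K V]

theorem powSum_mem {A : Module.End K V} {H : Submodule K V} (hA : ∀ f ∈ H, A f ∈ H) (n : ℕ)
    {f : V} (hf : f ∈ H) : powSum A n f ∈ H := by
  rw [powSum, LinearMap.sum_apply]
  refine Submodule.sum_mem _ fun i hi => ?_
  clear hi
  induction i with
  | zero => exact hf
  | succ i ih => rw [pow_succ', Module.End.mul_apply]; exact hA _ ih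

/-- An odd number of powers does not change the class of an invariant element modulo an invariant
subspace. -/
theorem powSum_sub_mem {A : Module.End K V} {H : Submodule K V}
    (hA : ∀ f ∈ H, A f ∈ H) {n : ℕ} (hn : (n : K) = 1) {f : V} (hf : A f - f ∈ H) :
    powSum A n f - f ∈ H := by
  have h : powSum A n f - f = ∑ i ∈ Finset.range n, ((A ^ i) f - f) := by
    rw [powSum, LinearMap.sum_apply, Finset.sum_sub_distrib, Finset.sum_const, Finset.card_range,
      ← Nat.cast_smul_eq_nsmul K, hn, one_smul]
  rw [h]
  refine Submodule.sum_mem _ fun i hi => ?_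
  clear hi
  induction i with
  | zero => simp
  | succ i ih =>
    rw [pow_succ', Module.End.mul_apply]
    convert add_mem (hA _ ih) hf using 1
    rw [map_sub]
    abel

end PowSum

/-! ### Orbits of monomials under rotation -/

namespace Expo

def rot (m : Expo) : Expo := ⟨m.b, m.c, m.d, m.e, m.a⟩

/-- The five rotations of an exponent vector. -/
def rots (m : Expo) : List Expo :=
  [m, m.rot, m.rot.rot, m.rot.rot.rot, m.rot.rot.rot.rot]

def minNat (m n : ℕ) : ℕ := cond (Nat.ble m n) m n

/-- The least of the packed rotations of an exponent vector. -/
def orbitKey (m : Expo) : ℕ :=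
  minNat m.pack (minNat m.rot.pack (minNat m.rot.rot.pack
    (minNat m.rot.rot.rot.pack m.rot.rot.rot.rot.pack)))

theorem minNat_eq (m n : ℕ) : minNat m n = m ∨ minNat m n = n := by
  unfold minNat
  cases Nat.ble m n <;> simp

/-- The exponents are small enough to be packed. -/
def Small (m : Expo) : Prop := m.a < 64 ∧ m.b < 64 ∧ m.c < 64 ∧ m.d < 64 ∧ m.e < 64

theorem orbitKey_cases (m : Expo) : m.orbitKey = m.pack ∨ m.orbitKey = m.rot.pack ∨
    m.orbitKey = m.rot.rot.pack ∨ m.orbitKey = m.rot.rot.rot.pack ∨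
    m.orbitKey = m.rot.rot.rot.rot.pack := by
  unfold orbitKey
  rcases minNat_eq m.pack (minNat m.rot.pack (minNat m.rot.rot.pack
    (minNat m.rot.rot.rot.pack m.rot.rot.rot.rot.pack))) with h | h <;> rw [h]
  · exact Or.inl rfl
  refine Or.inr ?_
  rcases minNat_eq m.rot.pack (minNat m.rot.rot.pack
    (minNat m.rot.rot.rot.pack m.rot.rot.rot.rot.pack)) with h | h <;> rw [h]
  · exact Or.inl rfl
  refine Or.inr ?_
  rcases minNat_eq m.rot.rot.pack
    (minNat m.rot.rot.rot.pack m.rot.rot.rot.rot.pack) with h | h <;> rw [h]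
  · exact Or.inl rfl
  exact Or.inr (minNat_eq _ _)

end Expo

section Orbit

variable (K : Type*) [Field K]

/-- The sum over the rotations of a polynomial. -/
def rotSum : Module.End K (MvPolynomial (Fin 5) K) := powSum rotMap.toLinearMap 5

variable {K}

theorem rotMap_mono (m : Expo) : rotMap (m.mono K) = m.rot.mono K := by
  simp only [Expo.mono, Expo.rot, map_mul, map_pow, rotMap, aeval_X,
    show (0 : Fin 5) + 4 = 4 from rfl, show (1 : Fin 5) + 4 = 0 from rfl,
    show (2 : Fin 5) + 4 = 1 from rfl, show (3 : Fin 5) + 4 = 2 from rfl,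
    show (4 : Fin 5) + 4 = 3 from rfl]
  ring

theorem rotSum_mono (m : Expo) : rotSum K (m.mono K) = monoSum K m.rots := by
  simp only [rotSum, powSum, Finset.sum_range_succ, Finset.range_zero, Finset.sum_empty, pow_succ,
    pow_zero, one_mul, LinearMap.add_apply, Module.End.mul_apply, AlgHom.toLinearMap_apply,
    rotMap_mono, monoSum, Expo.rots, List.map_cons, List.map_nil, List.sum_cons, List.sum_nil,
    Module.End.one_apply, zero_add, add_zero, add_assoc]

theorem rotSum_mono_rot (m : Expo) : rotSum K (m.rot.mono K) = rotSum K (m.mono K) := by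
  rw [rotSum_mono, rotSum_mono]
  simp only [monoSum, Expo.rots, List.map_cons, List.map_nil, List.sum_cons, List.sum_nil]
  -- The fifth rotation of `m` is `m` itself by definitional unfolding, so the two sums differ only
  -- in order.
  change _ + (_ + (_ + (_ + (m.mono K + 0)))) = _
  abel

theorem rotSum_orbitKey {m : Expo} (h : m.Small) :
    rotSum K ((Expo.unpack m.orbitKey).mono K) = rotSum K (m.mono K) := by
  obtain ⟨ha, hb, hc, hd, he⟩ := h
  rcases m.orbitKey_cases with h | h | h | h | h <;>
    rw [h, Expo.unpack_pack _ (by assumption) (by assumption) (by assumption) (by assumption)] <;>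
    simp only [rotSum_mono_rot]

theorem rotSum_mem_hits {f : MvPolynomial (Fin 5) K} (hf : f ∈ hits K true) :
    rotSum K f ∈ hits K true :=
  powSum_mem (fun _ h => rotMap_mem_hits h) 5 hf

end Orbit

/-! ### Relations between the orbit sums -/

/-- The terms of the twisted squares with values in degree 20 of some monomials. -/
def twistedTerms (hs : List ℕ) : List Expo :=
  listRec [] (fun h _ ih => cond (Nat.ble 20 (Expo.ofHex h).deg) ih
    (squareList (Expo.ofHex h) (Nat.sub 20 (Expo.ofHex h).deg) ((Expo.ofHex h).shift true) [] ++
      ih)) hs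

theorem small_of_mem_twistedTerms (hs : List ℕ) : ∀ t ∈ twistedTerms hs, t.Small := by
  induction hs with
  | nil => simp [twistedTerms, listRec]
  | cons h hs ih =>
    have e : twistedTerms (h :: hs) = cond (Nat.ble 20 (Expo.ofHex h).deg) (twistedTerms hs)
      (squareList (Expo.ofHex h) (Nat.sub 20 (Expo.ofHex h).deg) ((Expo.ofHex h).shift true) [] ++
        twistedTerms hs) := rfl
    rw [e]
    cases Nat.ble 20 (Expo.ofHex h).deg with
    | true => exact ih
    | false =>
      intro t ht
      rw [cond_false, List.mem_append] at ht
      rcases ht with ht | ht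
      · refine forall_mem_squareList Expo.Small _ _ _ ?_ t ht
        intro k₀ _ k₁ _ k₂ _ k₃ _ k₄ _ h₀ h₁ h₂ h₃ h₄ _
        simp only [Expo.Small, Expo.shift, cond_true, Expo.ofHex] at *
        omega
      · exact ih t ht

theorem monoSum_twistedTerms_mem {K : Type*} [Field K] [CharP K 2] (hs : List ℕ) :
    monoSum K (twistedTerms hs) ∈ hits K true := by
  induction hs with
  | nil => exact zero_mem _
  | cons h hs ih =>
    have e : twistedTerms (h :: hs) = cond (Nat.ble 20 (Expo.ofHex h).deg) (twistedTerms hs)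
      (squareList (Expo.ofHex h) (Nat.sub 20 (Expo.ofHex h).deg) ((Expo.ofHex h).shift true) [] ++
        twistedTerms hs) := rfl
    rw [e]
    cases hd : Nat.ble 20 (Expo.ofHex h).deg with
    | true => exact ih
    | false =>
      have hlt : ¬ 20 ≤ (Expo.ofHex h).deg := fun e => by
        rw [Nat.ble_eq_true_of_le e] at hd
        cases hd
      rw [cond_false, monoSum, List.map_append, List.sum_append]
      refine add_mem ?_ ih
      rw [sum_squareList true _ _ _ (Expo.mono K) fun k₀ k₁ k₂ k₃ k₄ h₀ h₁ h₂ h₃ h₄ =>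
        Expo.mono_shift K true _ _ _ _ _ _ h₀ h₁ h₂ h₃ h₄, List.map_nil, List.sum_nil, add_zero]
      exact coeff_totalSqOver_mem_hits (Nat.sub_pos_of_lt (not_le.1 hlt)) _

/-- Whether a number is among the keys of the given relations or among the further keys. -/
def isKnown (B : List ℕ) (D : List (ℕ × List ℕ)) (n : ℕ) : Bool :=
  listRec (listRec false (fun b _ ih => cond (Nat.beq b n) true ih) B)
    (fun s _ ih => cond (Nat.beq s.1 n) true ih) D

/-- The parity of the number of occurrences of `r` in a list whose other entries are known. -/
def parityModKnown (B : List ℕ) (D : List (ℕ × List ℕ)) (r : ℕ) (L : List ℕ) : Option Bool :=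
  listRec (some false) (fun n _ ih => cond (Nat.beq n r) (ih.map not)
    (cond (isKnown B D n) ih none)) L

/-- Whether every relation in a list expresses its key by keys of later ones and keys in `B`. -/
def relationsHold (B : List ℕ) (D : List (ℕ × List ℕ)) : Bool :=
  listRec true (fun s D ih => cond (parityModKnown B D s.1
    (mergeAll 4 ((twistedTerms s.2).map fun t => [t.orbitKey])) == some true) ih false) D

section Relations

variable {K : Type*} [Field K] {W : Submodule K (MvPolynomial (Fin 5) K)} {B : List ℕ}

/-- The orbit sum with the given key. -/
def orbitSum (K : Type*) [Field K] (n : ℕ) : MvPolynomial (Fin 5) K :=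
  rotSum K ((Expo.unpack n).mono K)

theorem orbitSum_mem_of_isKnown {D : List (ℕ × List ℕ)} (hB : ∀ b ∈ B, orbitSum K b ∈ W)
    (hD : ∀ s ∈ D, orbitSum K s.1 ∈ W) {n : ℕ} (h : isKnown B D n = true) : orbitSum K n ∈ W := by
  induction D with
  | nil =>
    clear hD
    induction B with
    | nil => cases h
    | cons b B ih =>
      change cond (Nat.beq b n) true (isKnown B [] n) = true at h
      cases hb : Nat.beq b n with
      | true => exact Nat.eq_of_beq_eq_true hb ▸ hB b List.mem_cons_self
      | false =>
        rw [hb] at h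
        exact ih (fun b hb => hB b (List.mem_cons_of_mem _ hb)) h
  | cons s D ih =>
    change cond (Nat.beq s.1 n) true (isKnown B D n) = true at h
    cases hb : Nat.beq s.1 n with
    | true => exact Nat.eq_of_beq_eq_true hb ▸ hD s List.mem_cons_self
    | false =>
      rw [hb] at h
      exact ih (fun s hs => hD s (List.mem_cons_of_mem _ hs)) h

theorem sum_sub_mem_of_parityModKnown [CharP K 2] {D : List (ℕ × List ℕ)}
    (hB : ∀ b ∈ B, orbitSum K b ∈ W) (hD : ∀ s ∈ D, orbitSum K s.1 ∈ W) (r : ℕ) (L : List ℕ)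
    (q : Bool) (h : parityModKnown B D r L = some q) :
    (L.map (orbitSum K)).sum - cond q (orbitSum K r) 0 ∈ W := by
  induction L generalizing q with
  | nil =>
    obtain rfl : false = q := Option.some.inj h
    simp
  | cons n L ih =>
    change cond (Nat.beq n r) ((parityModKnown B D r L).map not)
      (cond (isKnown B D n) (parityModKnown B D r L) none) = some q at h
    rw [List.map_cons, List.sum_cons]
    cases hn : Nat.beq n r with
    | true =>
      rw [hn, cond_true, Option.map_eq_some_iff] at h
      obtain ⟨q', h, rfl⟩ := h
      obtain rfl := Nat.eq_of_beq_eq_true hn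
      convert ih q' h using 1
      cases q' with
      | true =>
        simp only [Bool.not_true, cond_true, cond_false, sub_zero]
        rw [CharTwo.sub_eq_add, add_comm]
      | false =>
        simp
    | false =>
      rw [hn, cond_false] at h
      cases hk : isKnown B D n with
      | true =>
        rw [hk, cond_true] at h
        rw [add_sub_assoc]
        exact add_mem (orbitSum_mem_of_isKnown hB hD hk) (ih q h)
      | false =>
        rw [hk] at h
        cases h

/-- This is back substitution from the end of the list. Summing a hit polynomial over rotations
gives a hit combination of orbit sums, in which the key occurs an odd number of times and every
other entry already lies in `W`. -/
theorem orbitSum_mem_of_relationsHold [CharP K 2] (hW : hits K true ≤ W) {D : List (ℕ × List ℕ)}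
    (hB : ∀ b ∈ B, orbitSum K b ∈ W) (h : relationsHold B D = true) :
    ∀ s ∈ D, orbitSum K s.1 ∈ W := by
  induction D with
  | nil => simp
  | cons s D ih =>
    have e : relationsHold B (s :: D) = cond (parityModKnown B D s.1
      (mergeAll 4 ((twistedTerms s.2).map fun t => [t.orbitKey])) == some true)
      (relationsHold B D) false := rfl
    rw [e, Bool.cond_false_right, Bool.and_eq_true, beq_iff_eq] at h
    have hD := ih h.2
    intro s' hs'
    rcases List.mem_cons.1 hs' with rfl | hs'
    · have h1 := sum_sub_mem_of_parityModKnown hB hD _ _ _ h.1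
      rw [sum_mergeAll (orbitSum K) (fun x => CharTwo.add_self_eq_zero _), cond_true] at h1
      have h2 : (((twistedTerms s'.2).map fun t => [t.orbitKey]).map
          fun l => (l.map (orbitSum K)).sum).sum = rotSum K (monoSum K (twistedTerms s'.2)) := by
        rw [monoSum, map_list_sum, List.map_map, List.map_map]
        congr 1
        refine List.map_congr_left fun t ht => ?_
        simp only [Function.comp_apply, List.map_cons, List.map_nil, List.sum_cons, List.sum_nil,
          add_zero]
        exact rotSum_orbitKey (small_of_mem_twistedTerms _ t ht)
      rw [h2] at h1
      have h3 := sub_mem (hW (rotSum_mem_hits (monoSum_twistedTerms_mem (K := K) s'.2))) h1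
      rwa [sub_sub_cancel] at h3
    · exact hD s' hs'

end Relations

/-- The exponents of the monomials whose orbit sums span the classes of all orbit sums of
monomials of degree 20 and weight divisible by 31. -/
def orbitBasis : Fin 5 → Expo :=
  ![⟨0, 3, 3, 7, 7⟩, ⟨0, 3, 7, 1, 9⟩, ⟨0, 7, 1, 3, 9⟩, ⟨1, 2, 3, 3, 11⟩, ⟨1, 3, 7, 3, 6⟩]

/-- These are the packed forms of the entries of `orbitBasis`, in the same order. -/
def orbitBasisKeys : List ℕ := [799175, 815177, 1839305, 17313995, 17592518]

/-- Relations between orbit sums: the key of an orbit, and the monomials the sum of whose twisted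
squares expresses it by later ones. -/
def orbitRelations : List (ℕ × List ℕ) :=
  [(18096581, [0x13375]), (17584517, [0x13356]), (18112583, [0x13717]), (18624647, [0x23373]),
   (34369859, [0x13375, 0x13527]), (17568515, [0x13147]), (17056451, [0x11437]),
   (17072453, [0x11475]), (18903170, [0x03187]), (791174, [0x131a4]), (19415234, [0x16632]),
   (287111, [0x01477]), (1077698, [0x04753]), (1597763, [0x06273]), (17080454, [0x0711a]),
   (1847306, [0x08173]), (2109827, [0x00763]), (573635, [0x00d33]), (61571, [0x0f211]),
   (17048450, [0x00d33, 0x0d311]), (17576516, [0x03339]), (536654, [0x1231c]),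
   (3149957, [0x08325]), (35401988, [0x15427]), (34889924, [0x15256]), (34881923, [0x13546]),
   (18104582, [0x06615]), (17305994, [0x1214b]), (528653, [0x0210f]), (2637893, [0x08515]),
   (1311239, [0x01287]), (271109, [0x010d5]), (263108, [0x010b6]), (279110, [0x11494]),
   (17064452, [0x03168]), (34099337, [0x03529]), (34091336, [0x03358]), (807176, [0x04354]),
   (17834060, [0x18342]), (34377860, [0x05239]), (1319240, [0x0521a]), (1581761, [0x043b1]),
   (16589, [0x04392]), (2117828, [0x02853]), (1093700, [0x024b1]), (1327241, [0x01629]),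
   (1085699, [0x00b43]), (53570, [0x00972]), (1069697, [0x007a1]), (557633, [0x020d1]),
   (303113, [0x01249]), (295112, [0x01078]), (2101826, [0x00592]), (45569, [0x003c1]),
   (587, [0x0001f]), (4460609, [0x01911]), (68174084, [0x25444]), (2629892, [0x0540a]),
   (1605764, [0x04924]), (1589762, [0x01648]), (581636, [0x00f04]), (565634, [0x00b62]),
   (24590, [0x0041e]), (8588, [0x0007c])]

theorem relationsHold_orbitRelations : relationsHold orbitBasisKeys orbitRelations = true := by
  decide +kernel

/-- Whether all orbits of monomials of degree 20 and weight divisible by 31 are known. -/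
def allKnown (B : List ℕ) (D : List (ℕ × List ℕ)) : Bool :=
  allUpTo 20 fun a => allUpTo (20 - a) fun b => allUpTo (20 - a - b) fun c =>
    allUpTo (20 - a - b - c) fun d =>
      cond (Nat.beq ((a + 2 * b + 4 * c + 8 * d + 16 * (20 - a - b - c - d)) % 31) 0)
        (isKnown B D (Expo.orbitKey ⟨a, b, c, d, 20 - a - b - c - d⟩)) true

theorem allKnown_orbitRelations : allKnown orbitBasisKeys orbitRelations = true := by
  decide +kernel

/-- The weight by which the twisted diagonal maps act on a monomial. -/
def Expo.weight (m : Expo) : ℕ := m.a + 2 * m.b + 4 * m.c + 8 * m.d + 16 * m.e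

theorem rotSum_mono_mem_of_allKnown {K : Type*} [Field K] [CharP K 2]
    {W : Submodule K (MvPolynomial (Fin 5) K)} (hW : hits K true ≤ W) {B : List ℕ}
    {D : List (ℕ × List ℕ)} (hB : ∀ b ∈ B, orbitSum K b ∈ W) (hD : relationsHold B D = true)
    (h : allKnown B D = true) {m : Expo} (hm : m.deg = 20) (hw : m.weight % 31 = 0) :
    rotSum K (m.mono K) ∈ W := by
  obtain ⟨a, b, c, d, e⟩ := m
  simp only [Expo.deg, Expo.weight] at hm hw
  have h1 := allUpTo_eq_true (allUpTo_eq_true (allUpTo_eq_true (allUpTo_eq_true h a (by omega))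
    b (by omega)) c (by omega)) d (by omega)
  obtain rfl : e = 20 - a - b - c - d := by omega
  rw [hw, Nat.beq_refl, cond_true] at h1
  have hs : Expo.Small ⟨a, b, c, d, 20 - a - b - c - d⟩ := by
    simp only [Expo.Small]
    omega
  rw [← rotSum_orbitKey hs]
  exact orbitSum_mem_of_isKnown hB (orbitSum_mem_of_relationsHold hW hB hD) h1

/-- The orbit sums of the basis monomials. -/
def orbitBasisSum (K : Type*) [Field K] (i : Fin 5) : MvPolynomial (Fin 5) K :=
  rotSum K ((orbitBasis i).mono K)

theorem rotSum_mono_mem {K : Type*} [Field K] [CharP K 2] {m : Expo} (hm : m.deg = 20)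
    (hw : m.weight % 31 = 0) : rotSum K (m.mono K) ∈
      hits K true ⊔ Submodule.span K (Set.range (orbitBasisSum K)) := by
  refine rotSum_mono_mem_of_allKnown le_sup_left (B := orbitBasisKeys) (fun b hb => ?_)
    relationsHold_orbitRelations allKnown_orbitRelations hm hw
  refine Submodule.mem_sup_right (Submodule.subset_span ?_)
  simp only [orbitBasisKeys, List.mem_cons, List.not_mem_nil, or_false] at hb
  rcases hb with rfl | rfl | rfl | rfl | rfl
  exacts [⟨0, rfl⟩, ⟨1, rfl⟩, ⟨2, rfl⟩, ⟨3, rfl⟩, ⟨4, rfl⟩]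

end SteenrodHit

end

noncomputable section

namespace SteenrodHit

open MvPolynomial

/-! ### Projection to the monomials of weight divisible by 31 -/

section Weight

variable {K : Type*} [Field K]

theorem diagMap_mono (α : K) (m : Expo) :
    diagMap α (m.mono K) = α ^ m.weight • m.mono K := by
  simp only [Expo.mono, Expo.weight, map_mul, map_pow, diagMap, aeval_X, smul_pow, smul_mul_smul,
    ← pow_mul, ← pow_add]
  congr 2
  simp

theorem powSum_diagMap_mono (α : K) (m : Expo) (n : ℕ) :
    powSum (diagMap α).toLinearMap n (m.mono K) =
      (∑ i ∈ Finset.range n, (α ^ m.weight) ^ i) • m.mono K := by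
  rw [powSum, LinearMap.sum_apply, Finset.sum_smul]
  refine Finset.sum_congr rfl fun i hi => ?_
  clear hi
  induction i with
  | zero => simp
  | succ i ih =>
    rw [pow_succ', Module.End.mul_apply, ih, map_smul, AlgHom.toLinearMap_apply, diagMap_mono,
      smul_smul, ← pow_succ]

theorem deg_of_mem_support {f : MvPolynomial (Fin 5) K} {n : ℕ} (hf : f.IsHomogeneous n) {m : Expo}
    (hm : m.toFinsupp ∈ f.support) : m.deg = n := by
  have h : m.toFinsupp.degree = n := by
    rw [Finsupp.degree_eq_weight_one]
    exact hf (mem_support_iff.1 hm)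
  rw [Finsupp.degree_eq_sum, Fin.sum_univ_five] at h
  exact h

/-- A monomial of weight w is an eigenvector with eigenvalue α^w. If 31 does not divide w, the
geometric sum of the powers of α^w vanishes; the remaining monomials contribute multiples of orbit
sums, which are already reduced to the five basis sums. -/
theorem rotSum_powSum_diagMap_mem [CharP K 2] {α : K} (hα : orderOf α = 31)
    {f : MvPolynomial (Fin 5) K} (hf : f.IsHomogeneous 20) :
    rotSum K (powSum (diagMap α).toLinearMap 31 f) ∈
      hits K true ⊔ Submodule.span K (Set.range (orbitBasisSum K)) := by
  rw [← LinearMap.comp_apply, ← Submodule.mem_comap]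
  refine mem_of_mono_mem _ f fun m hm => ?_
  rw [Submodule.mem_comap, LinearMap.comp_apply, powSum_diagMap_mono, map_smul]
  by_cases hw : m.weight % 31 = 0
  · exact Submodule.smul_mem _ _ (rotSum_mono_mem (deg_of_mem_support hf hm) hw)
  · have h1 : α ^ m.weight - 1 ≠ 0 := fun h => hw (Nat.mod_eq_zero_of_dvd
      (hα ▸ orderOf_dvd_of_pow_eq_one (sub_eq_zero.1 h)))
    have h2 : (∑ i ∈ Finset.range 31, (α ^ m.weight) ^ i) * (α ^ m.weight - 1) = 0 := by
      rw [geom_sum_mul, ← pow_mul, mul_comm, pow_mul, ← hα, pow_orderOf_eq_one, one_pow, sub_self]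
    rw [(mul_eq_zero.1 h2).resolve_right h1, zero_smul]
    exact zero_mem _

/-- The mixing map has coefficients in 𝔽₂ and commutes with the rotation of indices, so it commutes
with the twisted total square. -/
theorem mixMap_mem_hits [CharP K 2] {f : MvPolynomial (Fin 5) K} (hf : f ∈ hits K true) :
    mixMap f ∈ hits K true := by
  refine map_mem_hits _ (fun i => ?_) hf
  have e : ∀ i : Fin 5, i + 2 + 4 = i + 4 + 2 ∧ i + 3 + 4 = i + 4 + 3 := by decide
  simp only [mixMap, totalSqOver_X, squareSource, cond_true, aeval_X, map_add, map_pow,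
    Polynomial.map_add, Polynomial.map_mul, Polynomial.map_C, Polynomial.map_X, Polynomial.map_pow,
    RingHom.coe_coe, CharTwo.add_sq, add_mul, (e i).1, (e i).2]
  abel

end Weight

/-! ### The coefficients of the images of monomials under the mixing map -/

namespace Expo

def get (s : Expo) (j : Fin 5) : ℕ :=
  match j with
  | 0 => s.a
  | 1 => s.b
  | 2 => s.c
  | 3 => s.d
  | 4 => s.e

/-- The exponent vector with the exponent at `j` lowered by `q`. -/
def lower (s : Expo) (j : Fin 5) (q : ℕ) : Expo :=
  match j with
  | 0 => ⟨Nat.sub s.a q, s.b, s.c, s.d, s.e⟩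
  | 1 => ⟨s.a, Nat.sub s.b q, s.c, s.d, s.e⟩
  | 2 => ⟨s.a, s.b, Nat.sub s.c q, s.d, s.e⟩
  | 3 => ⟨s.a, s.b, s.c, Nat.sub s.d q, s.e⟩
  | 4 => ⟨s.a, s.b, s.c, s.d, Nat.sub s.e q⟩

theorem get_toFinsupp (s : Expo) (j : Fin 5) : s.toFinsupp j = s.get j := by
  fin_cases j <;> rfl

theorem toFinsupp_lower (s : Expo) (j : Fin 5) (q : ℕ) :
    (s.lower j q).toFinsupp = s.toFinsupp - Finsupp.single j q := by
  ext i
  fin_cases j <;> fin_cases i <;> simp [toFinsupp, lower]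

theorem coeff_X_pow_mul {K : Type*} [CommSemiring K] (s : Expo) (j : Fin 5) (q : ℕ)
    (f : MvPolynomial (Fin 5) K) : coeff s.toFinsupp (X j ^ q * f) =
      cond (Nat.ble q (s.get j)) (coeff (s.lower j q).toFinsupp f) 0 := by
  have e : Finsupp.single j q ≤ s.toFinsupp ↔ q ≤ s.get j := by
    rw [Finsupp.single_le_iff, get_toFinsupp]
  rw [X_pow_eq_monomial, coeff_monomial_mul', one_mul, toFinsupp_lower]
  by_cases h : q ≤ s.get j
  · rw [if_pos (e.2 h), Nat.ble_eq_true_of_le h, cond_true]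
  · rw [if_neg (mt e.1 h), Bool.eq_false_iff.2 fun e => h (Nat.le_of_ble_eq_true e), cond_false]

end Expo

/-- The number of ways to write `s` as a sum of `q` times a unit vector at one of the places
`j`, `j + 2` and `j + 3`, over the pairs `(j, q)` in a list. -/
def mixCount (L : List (Fin 5 × ℕ)) : Expo → ℕ :=
  listRec (fun s => cond (Nat.beq s.deg 0) 1 0) (fun x _ ih s =>
    Nat.add (cond (Nat.ble x.2 (s.get x.1)) (ih (s.lower x.1 x.2)) 0)
      (Nat.add (cond (Nat.ble x.2 (s.get (x.1 + 2))) (ih (s.lower (x.1 + 2) x.2)) 0)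
        (cond (Nat.ble x.2 (s.get (x.1 + 3))) (ih (s.lower (x.1 + 3) x.2)) 0))) L

/-- Raising to the power 2^n is additive. Each factor x_j^(2^n) therefore splits into exactly three
terms, and a coefficient counts the choices of one term from each factor. -/
theorem coeff_mixMap_prod {K : Type*} [Field K] [CharP K 2] (L : List (Fin 5 × ℕ))
    (hL : ∀ x ∈ L, ∃ n, x.2 = 2 ^ n) (s : Expo) :
    coeff s.toFinsupp (mixMap (L.map fun x => (X x.1 : MvPolynomial (Fin 5) K) ^ x.2).prod) =
      (mixCount L s : K) := by
  induction L generalizing s with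
  | nil =>
    have e : mixCount [] s = cond (Nat.beq s.deg 0) 1 0 := rfl
    rw [List.map_nil, List.prod_nil, map_one, coeff_one, e]
    by_cases h : s.deg = 0
    · have hs : s = ⟨0, 0, 0, 0, 0⟩ := by
        obtain ⟨a, b, c, d, e⟩ := s
        simp only [Expo.deg, Expo.mk.injEq] at *
        omega
      subst hs
      have h0 : (0 : Fin 5 →₀ ℕ) = Expo.toFinsupp ⟨0, 0, 0, 0, 0⟩ := by
        ext i
        fin_cases i <;> rfl
      rw [if_pos h0, h, Nat.beq_refl, cond_true, Nat.cast_one]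
    · rw [Bool.eq_false_iff.2 fun e => h (Nat.eq_of_beq_eq_true e), cond_false, Nat.cast_zero,
        if_neg]
      intro h0
      apply h
      rw [← Expo.ofFinsupp_toFinsupp s, ← h0]
      rfl
  | cons x L ih =>
    have ih' := ih fun y hy => hL y (List.mem_cons_of_mem _ hy)
    have e : mixCount (x :: L) s =
      cond (Nat.ble x.2 (s.get x.1)) (mixCount L (s.lower x.1 x.2)) 0 +
      (cond (Nat.ble x.2 (s.get (x.1 + 2))) (mixCount L (s.lower (x.1 + 2) x.2)) 0 +
        cond (Nat.ble x.2 (s.get (x.1 + 3))) (mixCount L (s.lower (x.1 + 3) x.2)) 0) := rfl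
    have hc : ∀ (b : Bool) (n : ℕ), ((cond b n 0 : ℕ) : K) = cond b (n : K) 0 := by
      intro b n
      cases b <;> simp
    have hmix : mixMap ((X x.1 : MvPolynomial (Fin 5) K) ^ x.2) =
        X x.1 ^ x.2 + (X (x.1 + 2) ^ x.2 + X (x.1 + 3) ^ x.2) := by
      obtain ⟨n, hn⟩ := hL x List.mem_cons_self
      rw [hn, map_pow, mixMap, aeval_X, add_pow_char_pow, add_pow_char_pow, add_assoc]
    rw [List.map_cons, List.prod_cons, map_mul, hmix, add_mul, add_mul, coeff_add, coeff_add,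
      Expo.coeff_X_pow_mul, Expo.coeff_X_pow_mul, Expo.coeff_X_pow_mul, e, Nat.cast_add,
      Nat.cast_add, hc, hc, hc, ih', ih', ih']

/-- The factors `x_j ^ 2 ^ n` of a monomial with exponents less than 16. -/
def binaryFactors (m : Expo) : List (Fin 5 × ℕ) :=
  [8, 4, 2, 1].flatMap fun q => [(0, m.a), (1, m.b), (2, m.c), (3, m.d), (4, m.e)].flatMap
    fun x => cond (Nat.beq (x.2 / q % 2) 1) [(x.1, q)] []

theorem prod_binaryFactors {K : Type*} [Field K] {m : Expo} (ha : m.a < 16) (hb : m.b < 16)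
    (hc : m.c < 16) (hd : m.d < 16) (he : m.e < 16) :
    ((binaryFactors m).map fun x => (X x.1 : MvPolynomial (Fin 5) K) ^ x.2).prod = m.mono K := by
  set w : Fin 5 × ℕ → MvPolynomial (Fin 5) K := fun x => X x.1 ^ x.2 with hw
  have key : ∀ (j : Fin 5) (n : ℕ), n < 16 → (X j : MvPolynomial (Fin 5) K) ^ n =
      ((cond (Nat.beq (n / 8 % 2) 1) [(j, 8)] []).map w).prod *
      ((cond (Nat.beq (n / 4 % 2) 1) [(j, 4)] []).map w).prod *
      ((cond (Nat.beq (n / 2 % 2) 1) [(j, 2)] []).map w).prod *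
      ((cond (Nat.beq (n / 1 % 2) 1) [(j, 1)] []).map w).prod := by
    intro j n hn
    interval_cases n <;> simp [Nat.beq, hw] <;> ring
  rw [Expo.mono, key 0 _ ha, key 1 _ hb, key 2 _ hc, key 3 _ hd, key 4 _ he]
  simp only [binaryFactors, List.flatMap_cons, List.flatMap_nil, List.map_append, List.prod_append,
    List.append_nil]
  ring

theorem exists_two_pow_of_mem_binaryFactors (m : Expo) :
    ∀ x ∈ binaryFactors m, ∃ n, x.2 = 2 ^ n := by
  intro x hx
  simp only [binaryFactors, List.mem_flatMap] at hx
  obtain ⟨q, hq, y, _, hx⟩ := hx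
  have hx2 : x.2 = q := by
    cases h : Nat.beq (y.2 / q % 2) 1 <;> rw [h] at hx <;> simp at hx
    rw [hx]
  simp only [List.mem_cons, List.not_mem_nil, or_false] at hq
  rw [hx2]
  rcases hq with rfl | rfl | rfl | rfl
  exacts [⟨3, rfl⟩, ⟨2, rfl⟩, ⟨1, rfl⟩, ⟨0, rfl⟩]

/-- The value, as a natural number, of a sum of coefficients on the image of a monomial under the
mixing map. -/
def mixPairing (S : List Expo) (m : Expo) : ℕ :=
  listRec 0 (fun s _ ih => Nat.add (mixCount (binaryFactors m) s) ih) S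

theorem coeffSum_mixMap_mono {K : Type*} [Field K] [CharP K 2] (S : List Expo) {m : Expo}
    (ha : m.a < 16) (hb : m.b < 16) (hc : m.c < 16) (hd : m.d < 16) (he : m.e < 16) :
    coeffSum K S (mixMap (m.mono K)) = (mixPairing S m : K) := by
  induction S with
  | nil => simp [coeffSum_nil, mixPairing, listRec]
  | cons s S ih =>
    have e : mixPairing (s :: S) m = mixCount (binaryFactors m) s + mixPairing S m := rfl
    rw [coeffSum_cons, ih, e, Nat.cast_add, ← coeff_mixMap_prod _
      (exists_two_pow_of_mem_binaryFactors m), prod_binaryFactors ha hb hc hd he]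

/-- The value of a sum of coefficients on the difference between an orbit sum and its image under
the mixing map. -/
def mixDefect (S : List Expo) (m : Expo) : ℕ :=
  listRec 0 (fun t _ ih => Nat.add (Nat.add (mixPairing S t) (multiplicity S t)) ih) m.rots

theorem coeffSum_mixMap_rotSum_sub {K : Type*} [Field K] [CharP K 2] (S : List Expo) {m : Expo}
    (ha : m.a < 16) (hb : m.b < 16) (hc : m.c < 16) (hd : m.d < 16) (he : m.e < 16) :
    coeffSum K S (mixMap (rotSum K (m.mono K)) - rotSum K (m.mono K)) = (mixDefect S m : K) := by
  have e : mixDefect S m = (m.rots.map fun t => mixPairing S t + multiplicity S t).sum := rfl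
  rw [rotSum_mono, monoSum, CharTwo.sub_eq_add, map_list_sum, map_add, map_list_sum, map_list_sum,
    e, Nat.cast_list_sum, List.map_map, List.map_map, List.map_map, List.map_map,
    ← List.sum_map_add]
  congr 1
  refine List.map_congr_left fun t ht => ?_
  have hs : t.a < 16 ∧ t.b < 16 ∧ t.c < 16 ∧ t.d < 16 ∧ t.e < 16 := by
    simp only [Expo.rots, List.mem_cons, List.not_mem_nil, or_false] at ht
    rcases ht with rfl | rfl | rfl | rfl | rfl
    exacts [⟨ha, hb, hc, hd, he⟩, ⟨hb, hc, hd, he, ha⟩, ⟨hc, hd, he, ha, hb⟩, ⟨hd, he, ha, hb, hc⟩,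
      ⟨he, ha, hb, hc, hd⟩]
  simp only [Function.comp_apply, Nat.cast_add]
  rw [coeffSum_mixMap_mono S hs.1 hs.2.1 hs.2.2.1 hs.2.2.2.1 hs.2.2.2.2, coeffSum_mono]

/-- The monomials of four functionals which vanish on the hit polynomials of the twisted squares. -/
def mixDetector : Fin 4 → List Expo :=
  ![[⟨7, 3, 3, 1, 6⟩], [⟨3, 1, 0, 9, 7⟩], [⟨1, 1, 10, 5, 3⟩, ⟨1, 3, 7, 6, 3⟩, ⟨1, 5, 4, 7, 3⟩],
    [⟨1, 3, 7, 6, 3⟩, ⟨3, 2, 5, 7, 3⟩]]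

theorem vanishes_mixDetector : ∀ k, vanishes true (fun _ => true) (mixDetector k) = true := by
  decide +kernel

/-- The matrix has rank 4, and its kernel is spanned by the basis vector with index 3. -/
theorem mixDefect_mod_two : ∀ k i, mixDefect (mixDetector k) (orbitBasis i) % 2 =
    ![![0, 0, 0, 0, 1], ![0, 1, 1, 0, 0], ![0, 1, 0, 0, 0], ![1, 0, 0, 0, 1]] k i := by
  decide +kernel

end SteenrodHit

end

noncomputable section

namespace SteenrodHit

open MvPolynomial

/-! ### Invariant classes in twisted coordinates -/

section Invariant

variable {K : Type*} [Field K] [CharP K 2]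

theorem coeffSum_mixDetector (k : Fin 4) (i : Fin 5) :
    coeffSum K (mixDetector k) (mixMap (orbitBasisSum K i) - orbitBasisSum K i) =
      ((![![0, 0, 0, 0, 1], ![0, 1, 1, 0, 0], ![0, 1, 0, 0, 0],
        ![1, 0, 0, 0, 1]] k i : ℕ) : K) := by
  have hb : ∀ i, (orbitBasis i).a < 16 ∧ (orbitBasis i).b < 16 ∧ (orbitBasis i).c < 16 ∧
      (orbitBasis i).d < 16 ∧ (orbitBasis i).e < 16 := by decide
  obtain ⟨h0, h1, h2, h3, h4⟩ := hb i
  rw [orbitBasisSum, coeffSum_mixMap_rotSum_sub _ h0 h1 h2 h3 h4, ← mixDefect_mod_two]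
  conv_lhs => rw [← Nat.mod_add_div (mixDefect (mixDetector k) (orbitBasis i)) 2]
  rw [Nat.cast_add, Nat.cast_mul, Nat.cast_ofNat, CharTwo.two_eq_zero (R := K), zero_mul, add_zero]

/-- A polynomial of degree 20 whose class is invariant under the three generating maps is a
multiple of one orbit sum modulo hit polynomials. -/
theorem exists_sub_smul_mem_hits {α : K} (hα : orderOf α = 31) {f : MvPolynomial (Fin 5) K}
    (hf : f.IsHomogeneous 20) (hdiag : diagMap α f - f ∈ hits K true)
    (hrot : rotMap f - f ∈ hits K true) (hmix : mixMap f - f ∈ hits K true) :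
    ∃ c : K, f - c • orbitBasisSum K 3 ∈ hits K true := by
  have hα32 : α ^ 32 = α := by
    rw [pow_succ, ← hα, pow_orderOf_eq_one, one_mul]
  -- The orders 31 and 5 are odd, so the sums over powers act as projections without division.
  have c31 : ((31 : ℕ) : K) = 1 := by
    rw [show 31 = 2 * 15 + 1 from rfl, Nat.cast_add, Nat.cast_mul, Nat.cast_ofNat,
      CharTwo.two_eq_zero, zero_mul, zero_add, Nat.cast_one]
  have c5 : ((5 : ℕ) : K) = 1 := by
    rw [show 5 = 2 * 2 + 1 from rfl, Nat.cast_add, Nat.cast_mul, Nat.cast_ofNat,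
      CharTwo.two_eq_zero, zero_mul, zero_add, Nat.cast_one]
  have h1 : powSum (diagMap α).toLinearMap 31 f - f ∈ hits K true :=
    powSum_sub_mem (A := (diagMap α).toLinearMap) (n := 31)
      (fun _ h => diagMap_mem_hits hα32 h) c31 hdiag
  have h2 : rotSum K f - f ∈ hits K true :=
    powSum_sub_mem (fun _ h => rotMap_mem_hits h) c5 hrot
  have h3 := rotSum_mem_hits h1
  rw [map_sub] at h3
  have h4 := rotSum_powSum_diagMap_mem hα hf
  generalize rotSum K (powSum (diagMap α).toLinearMap 31 f) = F at h3 h4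
  obtain ⟨u, hu, v, hv, huv⟩ := Submodule.mem_sup.1 h4
  obtain ⟨c, hc⟩ := (Submodule.mem_span_range_iff_exists_fun K).1 hv
  have h5 : f - v ∈ hits K true := by
    have := sub_mem (sub_mem hu h3) h2
    rw [← huv] at this
    convert this using 1
    abel
  -- Invariance passes from `f` to `v` through mixMap v - v = (mixMap f - f) + (f - v) - mixMap (f -
  -- v).
  have h6 : mixMap v - v ∈ hits K true := by
    have := sub_mem (add_mem hmix h5) (mixMap_mem_hits h5)
    rw [map_sub] at this
    convert this using 1
    abel
  rw [← hc, map_sum, ← Finset.sum_sub_distrib] at h6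
  have h7 : ∀ k : Fin 4, ∑ i : Fin 5, c i *
      ((![![0, 0, 0, 0, 1], ![0, 1, 1, 0, 0], ![0, 1, 0, 0, 0], ![1, 0, 0, 0, 1]] k i : ℕ) : K) =
        0 := by
    intro k
    rw [← coeffSum_eq_zero_of_mem_hits (vanishes_mixDetector k) h6, map_sum]
    refine Finset.sum_congr rfl fun i _ => ?_
    rw [map_smul, ← smul_sub, map_smul, coeffSum_mixDetector, smul_eq_mul]
  -- The four equations read c₄ = 0, c₁ + c₂ = 0, c₁ = 0 and c₀ + c₄ = 0, which leaves only c₃ free.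
  have e0 := h7 0
  have e1 := h7 1
  have e2 := h7 2
  have e3 := h7 3
  simp [Fin.sum_univ_five] at e0 e1 e2 e3
  rw [e0, add_zero] at e3
  rw [e2, zero_add] at e1
  refine ⟨c 3, ?_⟩
  rw [← hc, Fin.sum_univ_five, e0, e1, e2, e3] at h5
  simpa using h5

end Invariant

/-! ### The field of scalars and the generating matrices -/

abbrev F : Type := AlgebraicClosure (ZMod 2)

theorem exists_root : ∃ α : F, α ^ 5 = α ^ 2 + 1 := by
  have hd : (Polynomial.X ^ 5 - (Polynomial.X ^ 2 + 1) : Polynomial F).degree ≠ 0 := by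
    have : (Polynomial.X ^ 5 - (Polynomial.X ^ 2 + 1) : Polynomial F).degree = 5 := by
      compute_degree!
    rw [this]
    decide
  obtain ⟨α, hα⟩ := IsAlgClosed.exists_root _ hd
  refine ⟨α, ?_⟩
  simpa [Polynomial.IsRoot, sub_eq_zero] using hα

/-- Multiplication by a root `α` of `α⁵ = α² + 1` on the span of the powers of `α`. -/
def singer : GL (Fin 5) (ZMod 2) :=
  ⟨!![0,0,0,0,1;1,0,0,0,0;0,1,0,0,1;0,0,1,0,0;0,0,0,1,0],
    !![0,1,0,0,0;1,0,1,0,0;0,0,0,1,0;0,0,0,0,1;1,0,0,0,0], by decide +kernel, by decide +kernel⟩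

/-- The map `δ ↦ δ²` on the span of the powers of `α`. -/
def frobenius : GL (Fin 5) (ZMod 2) :=
  ⟨!![1,0,0,0,1;0,0,0,1,0;0,1,0,0,1;0,0,0,1,1;0,0,1,0,0],
    !![1,1,0,1,0;0,1,1,1,0;0,0,0,0,1;0,1,0,0,0;0,1,0,1,0], by decide +kernel, by decide +kernel⟩

/-- The map `δ ↦ δ + δ⁴ + δ⁸` on the span of the powers of `α`. -/
def mixing : GL (Fin 5) (ZMod 2) :=
  ⟨!![1,1,0,0,1;0,1,1,0,0;0,1,0,0,0;0,1,0,1,1;0,1,1,1,0],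
    !![1,1,0,1,1;0,0,1,0,0;0,1,1,0,0;0,1,0,0,1;0,1,1,1,1], by decide +kernel, by decide +kernel⟩

/-! ### Arithmetic of the powers of α -/

section Root

variable {K : Type*} [Field K] [CharP K 2] {α : K}

/-- Modulo 2 the polynomial x⁵ + x² + 1 divides x³¹ - 1. -/
theorem pow_thirtyOne_of_root (hα : α ^ 5 = α ^ 2 + 1) : α ^ 31 = 1 := by
  have h2 : (2 : K) = 0 := CharTwo.two_eq_zero
  grind

/-- As 31 is prime, only α = 1 has to be excluded; irreducibility of x⁵ + x² + 1 is not used. -/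
theorem orderOf_root (hα : α ^ 5 = α ^ 2 + 1) : orderOf α = 31 := by
  have : Fact (Nat.Prime 31) := ⟨by norm_num⟩
  refine orderOf_eq_prime (pow_thirtyOne_of_root hα) fun h => ?_
  rw [h, one_pow, one_pow, CharTwo.add_self_eq_zero] at hα
  exact one_ne_zero hα

/-- The sum is the trace of α^n from 𝔽₃₂ to 𝔽₂. The range 25 to 33 covers the products of the powers
1, …, α⁴ with the elements of the dual basis. -/
theorem trace_pow (hα : α ^ 5 = α ^ 2 + 1) (n : ℕ) (h₁ : 25 ≤ n) (h₂ : n ≤ 33) :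
    ∑ i : Fin 5, (α ^ n) ^ 2 ^ (i : ℕ) = if n = 26 ∨ n = 31 then 1 else 0 := by
  have h2 : (2 : K) = 0 := CharTwo.two_eq_zero
  have h31 := pow_thirtyOne_of_root hα
  have hr : ∀ n, α ^ n = α ^ (n % 31) := fun n => by
    conv_lhs => rw [← Nat.mod_add_div n 31, pow_add, pow_mul, h31, one_pow, mul_one]
  have key : ∑ i : Fin 5, (α ^ n) ^ 2 ^ (i : ℕ) = α ^ (n % 31) + α ^ (n * 2 % 31) +
      α ^ (n * 4 % 31) + α ^ (n * 8 % 31) + α ^ (n * 16 % 31) := by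
    rw [← hr, ← hr, ← hr, ← hr, ← hr, Fin.sum_univ_five]
    simp [pow_mul]
  rw [key]
  interval_cases n <;> norm_num only [] <;> grind

/-- The coordinates of the variables and those of the dual basis under the trace form. -/
theorem sum_conj_mul_conj (hα : α ^ 5 = α ^ 2 + 1) (j k : Fin 5) :
    ∑ i : Fin 5, (α ^ (j : ℕ)) ^ 2 ^ (i : ℕ) * (α ^ ![26, 25, 29, 28, 27] k) ^ 2 ^ (i : ℕ) =
      if j = k then 1 else 0 := by
  have hd : ∀ j k : Fin 5, 25 ≤ (j : ℕ) + ![26, 25, 29, 28, 27] k ∧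
      (j : ℕ) + ![26, 25, 29, 28, 27] k ≤ 33 ∧
      (((j : ℕ) + ![26, 25, 29, 28, 27] k = 26 ∨ (j : ℕ) + ![26, 25, 29, 28, 27] k = 31) ↔
        j = k) := by decide
  simp only [← mul_pow, ← pow_add]
  rw [trace_pow hα _ (hd j k).1 (hd j k).2.1]
  simp only [(hd j k).2.2]

end Root

/-! ### Transfer between 𝔽₂ and the twisted coordinates -/

section Twisted

theorem pow_pow_thirtyTwo {K : Type*} [Field K] [CharP K 2] {α : K} (hα : α ^ 5 = α ^ 2 + 1)
    (n : ℕ) : (α ^ n) ^ 32 = α ^ n := by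
  rw [← pow_mul, mul_comm, pow_mul, pow_succ, pow_thirtyOne_of_root hα, one_mul]

theorem extend_mem_of_twist_mem {K : Type*} [Field K] [CharP K 2] {α : K}
    (hα : α ^ 5 = α ^ 2 + 1) {f : MvPolynomial (Fin 5) K}
    (hf : toTwisted (fun j : Fin 5 => α ^ (j : ℕ)) f ∈ hits K true) : f ∈ hits K false := by
  rw [← ofTwisted_toTwisted (sum_conj_mul_conj hα) f]
  exact ofTwisted_mem_hits (fun _ => pow_pow_thirtyTwo hα _) hf

variable {K : Type*} [Field K] [Algebra (ZMod 2) K] {α : K}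

/-- Extension of scalars, followed by the change to twisted coordinates. -/
def twist (α : K) : Poly 5 →+* MvPolynomial (Fin 5) K :=
  (toTwisted fun j => α ^ (j : ℕ) : MvPolynomial (Fin 5) K →+* MvPolynomial (Fin 5) K).comp
    (extend K)

theorem twist_apply (α : K) (f : Poly 5) :
    twist α f = toTwisted (fun j : Fin 5 => α ^ (j : ℕ)) (extend K f) := rfl

theorem isHomogeneous_twist {f : Poly 5} {n : ℕ} (hf : f.IsHomogeneous n) :
    (twist α f).IsHomogeneous n := by
  rw [← one_mul n]
  refine (hf.map (algebraMap (ZMod 2) K)).aeval _ fun j => ?_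
  exact IsHomogeneous.sum _ _ _ fun i _ => by
    rw [smul_eq_C_mul]
    exact isHomogeneous_C_mul_X _ _

variable [CharP K 2]

theorem twist_mem_hits (hα : α ^ 5 = α ^ 2 + 1) {f : Poly 5} (hf : f ∈ hit 5) :
    twist α f ∈ hits K true :=
  toTwisted_mem_hits (fun _ => pow_pow_thirtyTwo hα _) (extend_mem_hits K (hit_eq_hits ▸ hf))

theorem map_twist_sub_mem (hα : α ^ 5 = α ^ 2 + 1) {f : Poly 5}
    {A : MvPolynomial (Fin 5) K →ₐ[K] MvPolynomial (Fin 5) K} (g : GL (Fin 5) (ZMod 2))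
    (hA : ∀ j : Fin 5, A (conjForm (α ^ (j : ℕ))) =
      conjForm (∑ k : Fin 5, algebraMap (ZMod 2) K (g.val k j) * α ^ (k : ℕ)))
    (hf : subst 5 g.val f - f ∈ hit 5) : A (twist α f) - twist α f ∈ hits K true := by
  have h1 := twist_mem_hits hα hf
  rw [map_sub] at h1
  have h2 : twist α (subst 5 g.val f) = A (twist α f) := toTwisted_subst g.val A hA f
  rwa [h2] at h1

/-- Column j of the matrix holds the coordinates of α · α^j in the basis 1, …, α⁴, so the
substitution becomes the diagonal map. The next two lemmas are the analogues for the other two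
matrices. -/
theorem diagMap_twist_sub_mem (hα : α ^ 5 = α ^ 2 + 1) {f : Poly 5}
    (hf : subst 5 singer.val f - f ∈ hit 5) : diagMap α (twist α f) - twist α f ∈ hits K true := by
  refine map_twist_sub_mem hα singer (fun j => ?_) hf
  rw [diagMap_conjForm]
  congr 1
  fin_cases j <;> simp [singer, Fin.sum_univ_five] <;> grind

theorem rotMap_twist_sub_mem (hα : α ^ 5 = α ^ 2 + 1) {f : Poly 5}
    (hf : subst 5 frobenius.val f - f ∈ hit 5) : rotMap (twist α f) - twist α f ∈ hits K true := by
  have h2 : (2 : K) = 0 := CharTwo.two_eq_zero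
  refine map_twist_sub_mem hα frobenius (fun j => ?_) hf
  rw [rotMap_conjForm (pow_pow_thirtyTwo hα _)]
  congr 1
  fin_cases j <;> simp [frobenius, Fin.sum_univ_five] <;> grind

theorem mixMap_twist_sub_mem (hα : α ^ 5 = α ^ 2 + 1) {f : Poly 5}
    (hf : subst 5 mixing.val f - f ∈ hit 5) : mixMap (twist α f) - twist α f ∈ hits K true := by
  have h2 : (2 : K) = 0 := CharTwo.two_eq_zero
  refine map_twist_sub_mem hα mixing (fun j => ?_) hf
  rw [mixMap_conjForm (pow_pow_thirtyTwo hα _)]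
  congr 1
  fin_cases j <;> simp [mixing, Fin.sum_univ_five] <;> grind

theorem exists_twist_sub_smul_mem_hits (hα : α ^ 5 = α ^ 2 + 1) {f : Poly 5}
    (hf : f.IsHomogeneous 20) (h : ∀ g : GL (Fin 5) (ZMod 2), subst 5 g.val f - f ∈ hit 5) :
    ∃ c : K, twist α f - c • orbitBasisSum K 3 ∈ hits K true :=
  exists_sub_smul_mem_hits (orderOf_root hα) (isHomogeneous_twist hf)
    (diagMap_twist_sub_mem hα (h singer)) (rotMap_twist_sub_mem hα (h frobenius))
    (mixMap_twist_sub_mem hα (h mixing))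

end Twisted

/-! ### Descent to 𝔽₂ and conclusion -/

theorem exists_functional :
    ∃ φ : Poly 5 →ₗ[ZMod 2] ZMod 2, (∀ f ∈ hit 5, φ f = 0) ∧ φ p = 1 := by
  have h := @coeffSum_pDetector_eq_zero
  have hp := coeffSum_pDetector_p
  generalize pDetector = S at h hp
  exact ⟨coeffSum (ZMod 2) S, fun f hf => h hf, hp⟩

/-- With f ≡ c s and p ≡ d s for the same orbit sum s over `F`, the combination d f - c p is hit
over `F`. Functionals over 𝔽₂ extend to `F`, and `φ₀` forces c = d φ₀(f). -/
theorem sub_smul_p_mem_hit {φ₀ : Poly 5 →ₗ[ZMod 2] ZMod 2} (hφ₀ : ∀ f ∈ hit 5, φ₀ f = 0)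
    (hp : φ₀ p = 1) {f : Poly 5} (hf : f.IsHomogeneous 20)
    (h : ∀ g : GL (Fin 5) (ZMod 2), subst 5 g.val f - f ∈ hit 5) :
    f - φ₀ f • p ∈ hit 5 := by
  obtain ⟨α, hα⟩ := exists_root
  obtain ⟨c, hc⟩ := exists_twist_sub_smul_mem_hits hα hf h
  obtain ⟨d, hd⟩ := exists_twist_sub_smul_mem_hits hα isHomogeneous_p
    fun g => subst_p_sub_mem g.val (Matrix.GeneralLinearGroup.det_ne_zero g)
  have hext : ∀ φ : Poly 5 →ₗ[ZMod 2] ZMod 2, (∀ f ∈ hit 5, φ f = 0) → ∀ a b : F,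
      a • extend F f + b • extend F p ∈ hits F false →
      a * algebraMap (ZMod 2) F (φ f) + b * algebraMap (ZMod 2) F (φ p) = 0 := by
    intro φ hφ a b hab
    have := extendFunctional_eq_zero F φ (fun f hf => hφ f (hit_eq_hits ▸ hf)) hab
    rwa [map_add, map_smul, map_smul, extendFunctional_extend, extendFunctional_extend,
      smul_eq_mul, smul_eq_mul] at this
  have hcomb : d • extend F f - c • extend F p ∈ hits F false := by
    refine extend_mem_of_twist_mem hα ?_
    rw [map_sub, map_smul, map_smul]
    convert sub_mem (Submodule.smul_mem _ d hc) (Submodule.smul_mem _ c hd) using 1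
    rw [smul_sub, smul_sub, smul_smul, smul_smul, mul_comm, sub_sub_sub_cancel_right]
    rfl
  rw [sub_eq_add_neg, ← neg_smul] at hcomb
  -- If d were zero, p would be hit over `F`, which contradicts the extension of `φ₀`.
  have hd0 : d ≠ 0 := by
    rintro rfl
    rw [zero_smul, sub_zero, twist_apply] at hd
    have h1 : extend F p ∈ hits F false := extend_mem_of_twist_mem hα hd
    have h2 := hext φ₀ hφ₀ 0 1
      (by rwa [zero_smul, one_smul, zero_add])
    rw [hp] at h2
    simp at h2
  have h1 := hext φ₀ hφ₀ _ _ hcomb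
  rw [hp, map_one, mul_one] at h1
  by_contra hne
  -- Were the difference not hit, some 𝔽₂-functional would vanish on hit polynomials but not on it.
  -- Its extension to `F`, applied to `hcomb`, gives d φ(f - φ₀(f) p) = 0, which is impossible since
  -- d ≠ 0.
  obtain ⟨φ, hφ, hle⟩ := Submodule.exists_le_ker_of_notMem hne
  have h2 := hext φ (fun f hf => hle hf) _ _ hcomb
  apply hφ
  have h3 : d * algebraMap (ZMod 2) F (φ (f - φ₀ f • p)) = 0 := by
    rw [map_sub, map_smul, smul_eq_mul, map_sub, map_mul, mul_sub]
    linear_combination h2 - algebraMap (ZMod 2) F (φ p) * h1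
  have h4 := (mul_eq_zero.1 h3).resolve_left hd0
  exact (map_eq_zero _).1 h4

theorem QPinv_eq_span : QPinv 5 20 = Submodule.span (ZMod 2) {cls 5 p} := by
  refine le_antisymm ?_ ((Submodule.span_singleton_le_iff_mem _ _).2 cls_p_mem_QPinv)
  obtain ⟨φ, hφ, hp⟩ := exists_functional
  rintro _ ⟨⟨f, hf, rfl⟩, hg⟩
  refine Submodule.mem_span_singleton.2 ⟨φ f, ?_⟩
  have h := sub_smul_p_mem_hit hφ hp hf fun g => (glAction_cls g f).1 (hg g)
  rw [← map_smul]
  exact ((Submodule.Quotient.eq (hit 5)).2 h).symm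

theorem cls_p_ne_zero : cls 5 p ≠ 0 := by
  intro h
  obtain ⟨φ, hφ, hp⟩ := exists_functional
  have h1 := hφ p ((Submodule.Quotient.mk_eq_zero (hit 5)).1 h)
  rw [hp] at h1
  exact one_ne_zero h1

end SteenrodHit

end

theorem theorem1p2 :
    Module.finrank (ZMod 2) (SteenrodHit.QPinv 5 20) = 1 ∧
      SteenrodHit.QPinv 5 20 =
        Submodule.span (ZMod 2) {SteenrodHit.cls 5 SteenrodHit.p} := by
  refine ⟨?_, SteenrodHit.QPinv_eq_span⟩
  rw [SteenrodHit.QPinv_eq_span]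
  exact finrank_span_singleton SteenrodHit.cls_p_ne_zero
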